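/- Let $E_{ij}$ denote the matrix units and, for $n\ge 1$, let $H_n\subset GL_n(\mathbb C)$ be the diagonal torus. For $g\in GL_n(\mathbb C)$ put $(g^\tau)_{ij}=g_{n+1-j,\,n+1-i}$ and $g^\iota=(g^\tau)^{-1}$. For $G$ of type $B,C,D$ put $\theta_G(g)=\mathcal S_G\,g^\iota\,\mathcal S_G^{-1}$, with $\mathcal S_B=\mathrm{diag}(1,-1,\dots,1)\in GL_{2\ell+1}$, $\mathcal S_C=\mathrm{diag}(1,-1,\dots,1,-1)\in GL_{2\ell}$, $\mathcal S_D=\mathcal S_C\cdot\mathrm{diag}(\mathrm{Id}_\ell,-\mathrm{Id}_\ell)$. Then $O_{2\ell+1}=(GL_{2\ell+1}(\mathbb C))^{\theta_B}$, $Sp_{2\ell}=(GL_{2\ell}(\mathbb C))^{\theta_C}$ and $O_{2\ell}=(GL_{2\ell}(\mathbb C))^{\theta_D}$; for each of these groups $G\subset GL_n(\mathbb C)$ let $H_G=H_n\cap G$. For a torus $H$ write $H^{(2)}=\{h\in H: h^2=1\}$. Simple root vectors: in $\mathfrak{gl}_n$, $e_i=E_{i,i+1}$ for $1\le i<n$.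 In $\mathrm{Lie}(G)$ let $e_k^G$, $1\le k\le\ell$, be given as follows. For $k=1$: $e^B_1=\sqrt2\,(E_{\ell,\ell+1}+E_{\ell+1,\ell+2})$, $e^C_1=E_{\ell,\ell+1}$, $e^D_1=E_{\ell-1,\ell+1}+E_{\ell,\ell+2}$. For $1<k\le\ell$: $e^B_k=E_{\ell+1-k,\ell+2-k}+E_{\ell+k,\ell+k+1}$ and $e^C_k=e^D_k=E_{\ell+1-k,\ell+2-k}+E_{\ell+k-1,\ell+k}$. In all cases $f=e^{t}$ (transpose). The Tits elements are $\dot s=\exp\bigl(\tfrac{\pi}{2}(f-e)\bigr)$; write $\dot s_i$ for those of $GL_n(\mathbb C)$ and $\dot s_k^G$ for those of $G$. Let $T_k\in GL_n(\mathbb C)$ be the diagonal matrix with $-1$ in place $k$ and $1$ elsewhere. The Tits group $W^T_{GL_n}$ is generated by the $\dot s_i$ $(1\le i<n)$ and $H_n^{(2)}$. For $G=O_{2\ell+1}$ or $Sp_{2\ell}$ the Tits group $W^T_G$ is generated by the $\dot s_k^G$ $(1\le k\le\ell)$ and $H_G^{(2)}$. For the disconnected group $G=O_{2\ell}$, $W^T_G$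 is generated by the $\dot s_k^D$ $(1\le k\le\ell)$, by $H_G^{(2)}$, and by the elements $g\in O_{2\ell}$ that induce the Dynkin diagram symmetry $R$ exchanging the nodes $1$ and $2$, i.e. $ge^D_kg^{-1}=e^D_{R(k)}$ and $gf^D_kg^{-1}=f^D_{R(k)}$ for $1\le k\le\ell$. **Proposition.** Let $G$ be $O_{2\ell+1}$ $(\ell\ge1)$, $Sp_{2\ell}$ $(\ell\ge1)$ or $O_{2\ell}$ $(\ell\ge2)$, and let $n$ be $2\ell+1$, $2\ell$, $2\ell$ respectively. Then, as subgroups of $GL_n(\mathbb C)$, $$\bigl(W^T_{GL_n}\bigr)^{\theta_G}=W^T_G ,$$ where the left side is $\{g\in W^T_{GL_n}:\theta_G(g)=g\}$. Moreover: 1. For $G=O_{2\ell+1}$: $\dot s^B_1=\dot s_\ell\dot s_{\ell+1}\dot s_\ell=\dot s_{\ell+1}\dot s_\ell\dot s_{\ell+1}$ and $\dot s^B_k=\dot s_{\ell+1-k}\dot s_{\ell+k}=\dot s_{\ell+k}\dot s_{\ell+1-k}$ for $1<k\le\ell$; the group $W^T_G$ is generated by $\dot s^B_1,\dots,\dot s^B_\ell$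 together with the 2-torsion elements $T_{\ell+1}$ and $T_\ell T_{\ell+2}$. 2. For $G=Sp_{2\ell}$: $\dot s^C_1=\dot s_\ell$ and $\dot s^C_k=\dot s_{\ell+1-k}\dot s_{\ell-1+k}=\dot s_{\ell-1+k}\dot s_{\ell+1-k}$ for $1<k\le\ell$; the group $W^T_G$ is generated by $\dot s^C_1,\dots,\dot s^C_\ell$. 3. For $G=O_{2\ell}$: $\dot s^D_1=\dot s_\ell\dot s_{\ell-1}\dot s_{\ell+1}^{-1}\dot s_\ell^{-1}=\dot s_\ell\dot s_{\ell+1}^{-1}\dot s_{\ell-1}\dot s_\ell^{-1}=T_{\ell-1}T_\ell\cdot\dot s_\ell\dot s_{\ell-1}\dot s_{\ell+1}\dot s_\ell$ and $\dot s^D_k=\dot s_{\ell+1-k}\dot s_{\ell-1+k}=\dot s_{\ell-1+k}\dot s_{\ell+1-k}$ for $1<k\le\ell$; the element $\dot R=T_\ell\dot s_\ell$ lies in $O_{2\ell}$ and induces the diagram symmetry $R$ in the above sense; and $W^T_G$ is generated by $\dot s^D_1,\dots,\dot s^D_\ell$, $T_\ell T_{\ell+1}$ and $\dot R$. -/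

import Mathlib

noncomputable section

namespace TitsFixed

/-- The group `GL_n(ℂ)`. -/
abbrev GLn (n : ℕ) : Type := Matrix.GeneralLinearGroup (Fin n) ℂ

/-- The matrix unit `E_{ij}` of size `n`, with rows and columns numbered from `1` to `n`. -/
def matUnit (n i j : ℕ) : Matrix (Fin n) (Fin n) ℂ :=
  Matrix.of fun a b => if a.val + 1 = i ∧ b.val + 1 = j then 1 else 0

/-- The reflection of a matrix at the opposite diagonal,
`(M^τ)_{ij} = M_{n+1-j, n+1-i}` (`Fin.rev` is the reversal `i ↦ n+1-i`). -/
def antiTranspose {n : ℕ} (M : Matrix (Fin n) (Fin n) ℂ) : Matrix (Fin n) (Fin n) ℂ :=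
  Matrix.of fun i j => M j.rev i.rev

theorem antiTranspose_mul {n : ℕ} (M N : Matrix (Fin n) (Fin n) ℂ) :
    antiTranspose (M * N) = antiTranspose N * antiTranspose M := by
  ext i j
  simp only [antiTranspose, Matrix.of_apply, Matrix.mul_apply]
  rw [← Equiv.sum_comp Fin.revPerm]
  simp [mul_comm]

theorem antiTranspose_one {n : ℕ} :
    antiTranspose (1 : Matrix (Fin n) (Fin n) ℂ) = 1 := by
  ext i j
  simp [antiTranspose, Matrix.one_apply, eq_comm]

theorem antiTranspose_antiTranspose {n : ℕ} (M : Matrix (Fin n) (Fin n) ℂ) :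
    antiTranspose (antiTranspose M) = M := by
  ext i j
  simp [antiTranspose]

/-- `g ↦ g^τ` on `GL_n(ℂ)`. -/
def antiTransposeGL {n : ℕ} (g : GLn n) : GLn n where
  val := antiTranspose g.val
  inv := antiTranspose (g⁻¹).val
  val_inv := by rw [← antiTranspose_mul, Units.inv_mul, antiTranspose_one]
  inv_val := by rw [← antiTranspose_mul, Units.mul_inv, antiTranspose_one]

/-- The involutive automorphism `ι : g ↦ (g^τ)⁻¹` of `GL_n(ℂ)`. -/
def iota (n : ℕ) : GLn n ≃* GLn n where
  toFun g := (antiTransposeGL g)⁻¹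
  invFun g := (antiTransposeGL g)⁻¹
  left_inv g := by
    apply Units.ext
    change antiTranspose (antiTranspose g.val) = g.val
    exact antiTranspose_antiTranspose _
  right_inv g := by
    apply Units.ext
    change antiTranspose (antiTranspose g.val) = g.val
    exact antiTranspose_antiTranspose _
  map_mul' g h := by
    apply Units.ext
    change antiTranspose ((g * h)⁻¹).val = antiTranspose (g⁻¹).val * antiTranspose (h⁻¹).val
    rw [_root_.mul_inv_rev, Units.val_mul, antiTranspose_mul]

/-- The automorphism `θ = Ad_S ∘ ι : g ↦ S (g^τ)⁻¹ S⁻¹` of `GL_n(ℂ)`. -/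
def theta {n : ℕ} (S : GLn n) : GLn n ≃* GLn n :=
  (iota n).trans (MulAut.conj S)

/-- The subgroup of `GL_n(ℂ)` of the fixed points of `θ`. -/
def fixedGroup {n : ℕ} (θ : GLn n ≃* GLn n) : Subgroup (GLn n) :=
  MonoidHom.eqLocus θ.toMonoidHom (MonoidHom.id (GLn n))

/-- The diagonal matrix with given invertible diagonal entries, as an element of `GL_n(ℂ)`. -/
def diagGL (n : ℕ) : (Fin n → ℂˣ) →* GLn n :=
  (Units.map (Matrix.diagonalRingHom (Fin n) ℂ : (Fin n → ℂ) →* Matrix (Fin n) (Fin n) ℂ)).comp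
    (MulEquiv.piUnits (M := fun _ : Fin n => ℂ)).symm.toMonoidHom

/-- `S_B` (size `2ℓ+1`) and `S_C` (size `2ℓ`): the matrix `diag(1, -1, 1, -1, …)`. -/
def alternatingGL (n : ℕ) : GLn n :=
  diagGL n fun a => (-1) ^ a.val

/-- `S_D = diag(1, -1, 1, …, -1) · diag(Id_ℓ, -Id_ℓ)` in `GL_{2ℓ}(ℂ)`. -/
def sD (ℓ : ℕ) : GLn (2 * ℓ) :=
  alternatingGL (2 * ℓ) * diagGL (2 * ℓ) fun a => if a.val < ℓ then 1 else -1

/-- `O_{2ℓ+1}(ℂ)`, the fixed subgroup of `θ_B` in `GL_{2ℓ+1}(ℂ)`. -/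
def groupB (ℓ : ℕ) : Subgroup (GLn (2 * ℓ + 1)) :=
  fixedGroup (theta (alternatingGL (2 * ℓ + 1)))

/-- `Sp_{2ℓ}(ℂ)`, the fixed subgroup of `θ_C` in `GL_{2ℓ}(ℂ)`. -/
def groupC (ℓ : ℕ) : Subgroup (GLn (2 * ℓ)) :=
  fixedGroup (theta (alternatingGL (2 * ℓ)))

/-- `O_{2ℓ}(ℂ)`, the fixed subgroup of `θ_D` in `GL_{2ℓ}(ℂ)`. -/
def groupD (ℓ : ℕ) : Subgroup (GLn (2 * ℓ)) :=
  fixedGroup (theta (sD ℓ))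

/-- The diagonal maximal torus of `GL_n(ℂ)`. -/
def torus (n : ℕ) : Subgroup (GLn n) :=
  (diagGL n).range

/-- The set of the elements of order at most two of a subgroup; for a torus this is its
2-torsion subgroup. -/
def twoTorsion {n : ℕ} (H : Subgroup (GLn n)) : Set (GLn n) :=
  {h | h ∈ H ∧ h ^ 2 = 1}

/-- The matrix exponential, as an element of `GL_n(ℂ)`. -/
def expGL {n : ℕ} (X : Matrix (Fin n) (Fin n) ℂ) : GLn n :=
  (Matrix.isUnit_exp X).unit

/-- The Tits element `e^{(π/2) J}`, `J = f - e`, of a pair `(e, f)` of opposite simple root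
vectors. -/
def titsElement {n : ℕ} (e f : Matrix (Fin n) (Fin n) ℂ) : GLn n :=
  expGL (((Real.pi / 2 : ℝ) : ℂ) • (f - e))

/-- The subgroup generated by the Tits elements of the simple root vectors `e_k, f_k`,
`1 ≤ k ≤ r`, and by the 2-torsion of the torus `H`. -/
def titsGroup {n : ℕ} (H : Subgroup (GLn n)) (r : ℕ)
    (e f : ℕ → Matrix (Fin n) (Fin n) ℂ) : Subgroup (GLn n) :=
  Subgroup.closure ({g | ∃ k ∈ Set.Icc 1 r, g = titsElement (e k) (f k)} ∪ twoTorsion H)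

/-! Type `A`: the group `GL_n(ℂ)`. -/

/-- The simple root vectors `e_i = E_{i,i+1}`, `1 ≤ i ≤ n - 1`, of `gl_n`. -/
def eA (n i : ℕ) : Matrix (Fin n) (Fin n) ℂ := matUnit n i (i + 1)

/-- The opposite simple root vectors `f_i = E_{i+1,i}` of `gl_n`. -/
def fA (n i : ℕ) : Matrix (Fin n) (Fin n) ℂ := matUnit n (i + 1) i

/-- The Tits element of the `i`-th simple root of `GL_n(ℂ)`, `1 ≤ i ≤ n - 1`. -/
def dotA (n i : ℕ) : GLn n := titsElement (eA n i) (fA n i)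

/-- The element `T_k = exp(π i E_{kk})`: the diagonal matrix with `-1` in the place `k` and
`1` in the other places. -/
def tA (n k : ℕ) : GLn n :=
  diagGL n fun a => if a.val + 1 = k then -1 else 1

/-- The Tits group of `GL_n(ℂ)`. -/
def titsGL (n : ℕ) : Subgroup (GLn n) :=
  titsGroup (torus n) (n - 1) (eA n) (fA n)

/-! Type `B`: the group `O_{2ℓ+1}(ℂ)`. -/

/-- The simple root vectors `e_k`, `1 ≤ k ≤ ℓ`, of `so_{2ℓ+1}`. -/
def eB (ℓ k : ℕ) : Matrix (Fin (2 * ℓ + 1)) (Fin (2 * ℓ + 1)) ℂ :=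
  if k = 1 then
    ((Real.sqrt 2 : ℝ) : ℂ) •
      (matUnit (2 * ℓ + 1) ℓ (ℓ + 1) + matUnit (2 * ℓ + 1) (ℓ + 1) (ℓ + 2))
  else
    matUnit (2 * ℓ + 1) (ℓ + 1 - k) (ℓ + 2 - k) + matUnit (2 * ℓ + 1) (ℓ + k) (ℓ + k + 1)

/-- The opposite simple root vectors `f_k`, `1 ≤ k ≤ ℓ`, of `so_{2ℓ+1}`. -/
def fB (ℓ k : ℕ) : Matrix (Fin (2 * ℓ + 1)) (Fin (2 * ℓ + 1)) ℂ :=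
  if k = 1 then
    ((Real.sqrt 2 : ℝ) : ℂ) •
      (matUnit (2 * ℓ + 1) (ℓ + 1) ℓ + matUnit (2 * ℓ + 1) (ℓ + 2) (ℓ + 1))
  else
    matUnit (2 * ℓ + 1) (ℓ + 2 - k) (ℓ + 1 - k) + matUnit (2 * ℓ + 1) (ℓ + k + 1) (ℓ + k)

/-- The Tits generator of `O_{2ℓ+1}(ℂ)` at the simple root `k`. -/
def dotB (ℓ k : ℕ) : GLn (2 * ℓ + 1) := titsElement (eB ℓ k) (fB ℓ k)

/-- The Tits group of `O_{2ℓ+1}(ℂ)`. -/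
def titsB (ℓ : ℕ) : Subgroup (GLn (2 * ℓ + 1)) :=
  titsGroup (torus (2 * ℓ + 1) ⊓ groupB ℓ) ℓ (eB ℓ) (fB ℓ)

/-! Type `C`: the group `Sp_{2ℓ}(ℂ)`. -/

/-- The simple root vectors `e_k`, `1 ≤ k ≤ ℓ`, of `sp_{2ℓ}`. -/
def eC (ℓ k : ℕ) : Matrix (Fin (2 * ℓ)) (Fin (2 * ℓ)) ℂ :=
  if k = 1 then matUnit (2 * ℓ) ℓ (ℓ + 1)
  else matUnit (2 * ℓ) (ℓ + 1 - k) (ℓ + 2 - k) + matUnit (2 * ℓ) (ℓ + k - 1) (ℓ + k)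

/-- The opposite simple root vectors `f_k`, `1 ≤ k ≤ ℓ`, of `sp_{2ℓ}`. -/
def fC (ℓ k : ℕ) : Matrix (Fin (2 * ℓ)) (Fin (2 * ℓ)) ℂ :=
  if k = 1 then matUnit (2 * ℓ) (ℓ + 1) ℓ
  else matUnit (2 * ℓ) (ℓ + 2 - k) (ℓ + 1 - k) + matUnit (2 * ℓ) (ℓ + k) (ℓ + k - 1)

/-- The Tits generator of `Sp_{2ℓ}(ℂ)` at the simple root `k`. -/
def dotC (ℓ k : ℕ) : GLn (2 * ℓ) := titsElement (eC ℓ k) (fC ℓ k)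

/-- The Tits group of `Sp_{2ℓ}(ℂ)`. -/
def titsC (ℓ : ℕ) : Subgroup (GLn (2 * ℓ)) :=
  titsGroup (torus (2 * ℓ) ⊓ groupC ℓ) ℓ (eC ℓ) (fC ℓ)

/-! Type `D`: the group `O_{2ℓ}(ℂ)`. -/

/-- The simple root vectors `e_k`, `1 ≤ k ≤ ℓ`, of `so_{2ℓ}`. -/
def eD (ℓ k : ℕ) : Matrix (Fin (2 * ℓ)) (Fin (2 * ℓ)) ℂ :=
  if k = 1 then matUnit (2 * ℓ) (ℓ - 1) (ℓ + 1) + matUnit (2 * ℓ) ℓ (ℓ + 2)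
  else matUnit (2 * ℓ) (ℓ + 1 - k) (ℓ + 2 - k) + matUnit (2 * ℓ) (ℓ + k - 1) (ℓ + k)

/-- The opposite simple root vectors `f_k`, `1 ≤ k ≤ ℓ`, of `so_{2ℓ}`. -/
def fD (ℓ k : ℕ) : Matrix (Fin (2 * ℓ)) (Fin (2 * ℓ)) ℂ :=
  if k = 1 then matUnit (2 * ℓ) (ℓ + 1) (ℓ - 1) + matUnit (2 * ℓ) (ℓ + 2) ℓ
  else matUnit (2 * ℓ) (ℓ + 2 - k) (ℓ + 1 - k) + matUnit (2 * ℓ) (ℓ + k) (ℓ + k - 1)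

/-- The Tits generator of `O_{2ℓ}(ℂ)` at the simple root `k`. -/
def dotD (ℓ k : ℕ) : GLn (2 * ℓ) := titsElement (eD ℓ k) (fD ℓ k)

/-- The Tits group of the identity component `SO_{2ℓ}(ℂ)` of `O_{2ℓ}(ℂ)` (the two groups have
the same diagonal torus). -/
def titsSOeven (ℓ : ℕ) : Subgroup (GLn (2 * ℓ)) :=
  titsGroup (torus (2 * ℓ) ⊓ groupD ℓ) ℓ (eD ℓ) (fD ℓ)

/-- The elements of `O_{2ℓ}(ℂ)` that induce the symmetry `R` of the Dynkin diagram `D_ℓ`,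
that is, whose adjoint action exchanges the simple root vectors at the nodes `1` and `2` and
fixes those at the other nodes. -/
def diagramLiftsD (ℓ : ℕ) : Set (GLn (2 * ℓ)) :=
  {g | g ∈ groupD ℓ ∧ ∀ k ∈ Set.Icc 1 ℓ,
    g.val * eD ℓ k * (g⁻¹).val = eD ℓ (Equiv.swap 1 2 k) ∧
    g.val * fD ℓ k * (g⁻¹).val = fD ℓ (Equiv.swap 1 2 k)}

/-- The Tits group of the disconnected group `O_{2ℓ}(ℂ)`: the extension of the Tits group of
`SO_{2ℓ}(ℂ)` by the diagram symmetry `R`. -/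
def titsD (ℓ : ℕ) : Subgroup (GLn (2 * ℓ)) :=
  titsSOeven ℓ ⊔ Subgroup.closure (diagramLiftsD ℓ)

end TitsFixed

end

/-! Everything takes place among signed permutation matrices `signedPerm σ ε`. The 2-torsion of the
torus consists of diagonal sign matrices, and each Tits element of `GL_n` is a quarter turn in a
coordinate plane, hence a signed transposition (`rot_eq`). On such matrices θ reverses rows and
columns and twists the signs, so being fixed means that σ commutes with the reversal of indices and
that ε satisfies a sign rule (`mem_fixedGroup_theta_signedPerm`).

In each type the equality of groups and the generation statement come from one cycle of inclusions:
fixed points of the Tits group ≤ closure of the small generating set ≤ Tits group of `G` ≤ fixed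
points. The last inclusion rests on explicit factorizations of the Tits elements of `G`. For two
commuting root vectors these follow from exp(X+Y) = exp X exp Y; the short root of type B needs a
half turn instead (`titsElement_short`).

The first inclusion is a sorting argument (`signedPerm_mem_of_lowering`,
`titsGL_inf_fixedGroup_le`). Left multiplication by mirror pairs of adjacent quarter turns and by a
swap across the centre moves the images of the indices 0, 1, 2, … into place one after another. What
remains is a diagonal matrix with mirror-symmetric signs; it is a product of mirror signs, all
conjugate to central ones.

In type D arbitrary lifts of the diagram symmetry must also be controlled. Two lifts differ by an
element of `O_{2ℓ}` that commutes with all simple root vectors; such an element is a scalar, so its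
square is 1 (`diagramLiftsD_subset`). -/

namespace TitsFixed

open Matrix

variable {n : ℕ}

/-! ### Signed permutation matrices and the action of θ on them -/

/-- The matrix that sends the `j`-th basis vector to `ε j` times the `σ j`-th one. -/
def signedPerm (σ : Equiv.Perm (Fin n)) (ε : Fin n → ℤˣ) : GLn n where
  val := Matrix.of fun i j => if i = σ j then (((ε j : ℤˣ) : ℤ) : ℂ) else 0
  inv := Matrix.of fun i j => if j = σ i then (((ε i : ℤˣ) : ℤ) : ℂ) else 0
  val_inv := by
    ext i j
    rw [Matrix.mul_apply, Finset.sum_eq_single (σ.symm i)]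
    · by_cases h : i = j
      · subst h
        simp [← Int.cast_mul, ← Units.val_mul]
      · simp [h, Ne.symm h]
    · intro b _ hb
      have : i ≠ σ b := fun h => hb (by simp [h])
      simp [this]
    · simp
  inv_val := by
    ext i j
    rw [Matrix.mul_apply, Finset.sum_eq_single (σ i)]
    · by_cases h : i = j
      · subst h
        simp [← Int.cast_mul, ← Units.val_mul]
      · simp [h]
    · intro b _ hb
      simp [hb]
    · simp

theorem signedPerm_apply (σ : Equiv.Perm (Fin n)) (ε : Fin n → ℤˣ) (i j : Fin n) :
    (signedPerm σ ε).val i j = if i = σ j then (((ε j : ℤˣ) : ℤ) : ℂ) else 0 := rfl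

theorem signedPerm_inv_apply (σ : Equiv.Perm (Fin n)) (ε : Fin n → ℤˣ) (i j : Fin n) :
    ((signedPerm σ ε)⁻¹).val i j = if j = σ i then (((ε i : ℤˣ) : ℤ) : ℂ) else 0 := rfl

theorem signedPerm_mul (σ τ : Equiv.Perm (Fin n)) (ε δ : Fin n → ℤˣ) :
    signedPerm σ ε * signedPerm τ δ = signedPerm (σ * τ) fun j => ε (τ j) * δ j := by
  apply Units.ext
  ext i j
  rw [Units.val_mul, Matrix.mul_apply, Finset.sum_eq_single (τ j)]
  · simp [signedPerm_apply]
  · intro b _ hb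
    simp [signedPerm_apply, hb]
  · simp

theorem signedPerm_one_one : signedPerm (1 : Equiv.Perm (Fin n)) (fun _ => 1) = 1 := by
  apply Units.ext
  ext i j
  simp [signedPerm_apply, Matrix.one_apply]

theorem signedPerm_inv (σ : Equiv.Perm (Fin n)) (ε : Fin n → ℤˣ) :
    (signedPerm σ ε)⁻¹ = signedPerm σ⁻¹ fun j => ε (σ⁻¹ j) := by
  rw [inv_eq_iff_mul_eq_one, signedPerm_mul, ← signedPerm_one_one]
  simp

theorem signedPerm_inj {σ τ : Equiv.Perm (Fin n)} {ε δ : Fin n → ℤˣ} :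
    signedPerm σ ε = signedPerm τ δ ↔ σ = τ ∧ ε = δ := by
  refine ⟨fun h => ?_, fun ⟨h₁, h₂⟩ => by rw [h₁, h₂]⟩
  have h' (i j) : (signedPerm σ ε).val i j = (signedPerm τ δ).val i j := by rw [h]
  simp only [signedPerm_apply] at h'
  have hσ : σ = τ := by
    ext1 j
    by_contra hne
    have := h' (σ j) j
    simp [hne] at this
  refine ⟨hσ, funext fun j => ?_⟩
  have := h' (σ j) j
  subst hσ
  simpa [Units.val_inj] using this

theorem diagGL_apply (a : Fin n → ℂˣ) (i j : Fin n) :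
    (diagGL n a).val i j = if i = j then (a j : ℂ) else 0 := by
  change Matrix.diagonal (fun i => (a i : ℂ)) i j = _
  rw [Matrix.diagonal_apply]
  split_ifs with h <;> simp [h]

theorem diagGL_eq_signedPerm {a : Fin n → ℂˣ} {ε : Fin n → ℤˣ}
    (h : ∀ i, (a i : ℂ) = (((ε i : ℤˣ) : ℤ) : ℂ)) : diagGL n a = signedPerm 1 ε := by
  apply Units.ext
  ext i j
  rw [diagGL_apply, signedPerm_apply, h]
  rfl

theorem alternatingGL_eq : alternatingGL n = signedPerm 1 fun a => (-1) ^ a.val :=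
  diagGL_eq_signedPerm fun i => by simp

theorem sD_eq (ℓ : ℕ) :
    sD ℓ = signedPerm 1 fun a => (-1) ^ a.val * if a.val < ℓ then 1 else -1 := by
  rw [sD, alternatingGL_eq, diagGL_eq_signedPerm (ε := fun a => if a.val < ℓ then 1 else -1),
    signedPerm_mul]
  · simp
  · intro i
    split_ifs <;> simp

theorem tA_eq (k : ℕ) : tA n k = signedPerm 1 fun a => if a.val + 1 = k then -1 else 1 :=
  diagGL_eq_signedPerm fun i => by split_ifs <;> simp

/-- The inverse of a signed permutation matrix is its transpose, so ι only reverses the order of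
rows and columns. Conjugation by the diagonal signs then contributes one factor from the row and one
from the column. -/
theorem theta_signedPerm (s : Fin n → ℤˣ) (σ : Equiv.Perm (Fin n)) (ε : Fin n → ℤˣ) :
    theta (signedPerm 1 s) (signedPerm σ ε) = signedPerm (Fin.revPerm * σ * Fin.revPerm)
      fun j => s (σ j.rev).rev * ε j.rev * s j := by
  have hι : iota n (signedPerm σ ε) =
      signedPerm (Fin.revPerm * σ * Fin.revPerm) fun j => ε j.rev := by
    apply Units.ext
    ext i j
    change ((signedPerm σ ε)⁻¹).val j.rev i.rev = _
    simp only [signedPerm_inv_apply, signedPerm_apply, Equiv.Perm.mul_apply, Fin.revPerm_apply,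
      Fin.rev_eq_iff]
  rw [theta, MulEquiv.trans_apply, hι, MulAut.conj_apply, signedPerm_mul, signedPerm_inv,
    signedPerm_mul]
  simp

theorem mem_fixedGroup_theta_signedPerm {s : Fin n → ℤˣ} {σ : Equiv.Perm (Fin n)}
    {ε : Fin n → ℤˣ} :
    signedPerm σ ε ∈ fixedGroup (theta (signedPerm 1 s)) ↔
      (∀ j, σ j.rev = (σ j).rev) ∧ ∀ j, ε j = ε j.rev * (s (σ j) * s j) := by
  change theta (signedPerm 1 s) (signedPerm σ ε) = signedPerm σ ε ↔ _
  rw [theta_signedPerm, signedPerm_inj]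
  have h₁ : Fin.revPerm * σ * Fin.revPerm = σ ↔ ∀ j, σ j.rev = (σ j).rev := by
    simp [Equiv.ext_iff, Fin.rev_eq_iff]
  rw [h₁]
  refine and_congr_right fun h => ?_
  rw [funext_iff]
  refine forall_congr' fun j => ?_
  rw [h, Fin.rev_rev, eq_comm, mul_comm (s _), mul_assoc]

/-- A group generated by signed permutation matrices consists of such matrices. -/
theorem exists_signedPerm_of_mem_closure {S : Set (GLn n)}
    (hS : ∀ g ∈ S, ∃ σ ε, g = signedPerm σ ε) {g : GLn n} (hg : g ∈ Subgroup.closure S) :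
    ∃ σ ε, g = signedPerm σ ε := by
  induction hg using Subgroup.closure_induction with
  | mem x hx => exact hS x hx
  | one => exact ⟨1, _, signedPerm_one_one.symm⟩
  | mul x y _ _ hx hy =>
    obtain ⟨σ, ε, rfl⟩ := hx
    obtain ⟨τ, δ, rfl⟩ := hy
    exact ⟨_, _, signedPerm_mul ..⟩
  | inv x _ hx =>
    obtain ⟨σ, ε, rfl⟩ := hx
    exact ⟨_, _, signedPerm_inv ..⟩

theorem exists_signedPerm_of_mem_twoTorsion {g : GLn n} (hg : g ∈ twoTorsion (torus n)) :
    ∃ ε, g = signedPerm 1 ε := by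
  obtain ⟨⟨a, rfl⟩, h⟩ := hg
  have ha (i) : (a i : ℂ) = 1 ∨ (a i : ℂ) = -1 := by
    rw [← sq_eq_one_iff]
    have : (diagGL n (a ^ 2)).val i i = (1 : GLn n).val i i := by rw [map_pow, h]
    rw [diagGL_apply] at this
    simpa using this
  refine ⟨fun i => if (a i : ℂ) = 1 then 1 else -1, diagGL_eq_signedPerm fun i => ?_⟩
  rcases ha i with h | h
  · simp [h]
  · rw [h]
    norm_num

theorem signedPerm_one_mem_twoTorsion (ε : Fin n → ℤˣ) :
    signedPerm 1 ε ∈ twoTorsion (torus n) := by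
  refine ⟨⟨fun i => Units.map (Int.castRingHom ℂ).toMonoidHom (ε i),
    diagGL_eq_signedPerm fun i => by simp⟩, ?_⟩
  rw [pow_two, signedPerm_mul, ← signedPerm_one_one]
  simp

/-! ### Mirror signs and generation by sorting -/

/-- The sign vector that is `-1` exactly at `c` and at its mirror image. -/
def mirrorSign (c : Fin n) : Fin n → ℤˣ := fun i => if i = c ∨ i = c.rev then -1 else 1

/-- The signs ε cancel because diagonal matrices commute, and σ carries the mirror pair of `c` to
that of `σ c` because it respects the reversal. -/
theorem mirrorSign_conj {σ : Equiv.Perm (Fin n)} (hσ : ∀ j, σ j.rev = (σ j).rev)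
    (ε : Fin n → ℤˣ) (c : Fin n) :
    signedPerm σ ε * signedPerm 1 (mirrorSign c) * (signedPerm σ ε)⁻¹ =
      signedPerm 1 (mirrorSign (σ c)) := by
  rw [signedPerm_inv, signedPerm_mul, signedPerm_mul, signedPerm_inj]
  refine ⟨by simp, funext fun j => ?_⟩
  obtain ⟨i, rfl⟩ := σ.surjective j
  simp [mirrorSign, ← hσ]

/-- Sweep from the front: at the first index with sign -1, multiply by its mirror sign, which by
symmetry also clears the mirror image. -/
theorem symmetric_signs_mem {K : Subgroup (GLn n)}
    (hK : ∀ c : Fin n, signedPerm 1 (mirrorSign c) ∈ K) (ε : Fin n → ℤˣ)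
    (hε : ∀ j, ε j = ε j.rev) : signedPerm 1 ε ∈ K := by
  suffices H : ∀ d m : ℕ, m + d = n → ∀ ε : Fin n → ℤˣ, (∀ j, ε j = ε j.rev) →
      (∀ j : Fin n, j.val < m → ε j = 1) → signedPerm 1 ε ∈ K from
    H n 0 (by simp) ε hε (by simp)
  intro d
  induction d with
  | zero =>
    intro m hm ε _ h
    have : ε = fun _ => 1 := funext fun j => h j (by omega)
    rw [this, signedPerm_one_one]
    exact one_mem K
  | succ d ih =>
    intro m hm ε hε h
    let c : Fin n := ⟨m, by omega⟩
    rcases Int.units_eq_one_or (ε c) with h1 | h1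
    · refine ih (m + 1) (by omega) ε hε fun j hj => ?_
      rcases Nat.lt_succ_iff_lt_or_eq.1 hj with hj | hj
      · exact h j hj
      · rw [← h1]
        exact congrArg ε (Fin.ext hj)
    · have hmem : signedPerm 1 (mirrorSign c) * signedPerm 1 ε ∈ K := by
        rw [signedPerm_mul]
        refine ih (m + 1) (by omega) _ (fun j => ?_) fun j hj => ?_
        · have : mirrorSign c j.rev = mirrorSign c j := by
            simp [mirrorSign, Fin.rev_eq_iff, or_comm]
          simp [← hε, this]
        · rcases Nat.lt_succ_iff_lt_or_eq.1 hj with hj | hj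
          · have hne : ¬(j = c ∨ j = c.rev) := by
              rintro (rfl | rfl)
              · exact lt_irrefl _ hj
              · have := h _ hj
                rw [← hε, h1] at this
                exact absurd this (by decide)
            simp [mirrorSign, hne, h j hj]
          · have : j = c := Fin.ext hj
            simp [mirrorSign, this, h1]
      exact (K.mul_mem_cancel_left (hK c)).1 hmem

/-- A subgroup of the fixed group of `θ` contains all fixed signed permutation matrices as soon
as it contains the central mirror signs and can move each basis line towards the front. -/
theorem signedPerm_mem_of_lowering {K : Subgroup (GLn n)} {s : Fin n → ℤˣ}
    (hK : K ≤ fixedGroup (theta (signedPerm 1 s)))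
    (hlow : ∀ m j : Fin n, m < j → j ≤ m.rev → j ≠ j.rev → ∃ τ δ, signedPerm τ δ ∈ K ∧
      m ≤ τ j ∧ τ j < j ∧ ∀ i < m, τ i = i)
    (hcentral : ∀ c : Fin n, c ≤ c.rev → c.rev.val ≤ c.val + 2 →
      signedPerm 1 (mirrorSign c) ∈ K)
    {σ : Equiv.Perm (Fin n)} {ε : Fin n → ℤˣ}
    (hg : signedPerm σ ε ∈ fixedGroup (theta (signedPerm 1 s))) : signedPerm σ ε ∈ K := by
  -- Mirror signs spread outwards from the centre: lowering `c + 1` within the range starting at `c`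
  -- must send it to `c`, so conjugation turns the mirror sign of `c + 1` into that of `c`.
  have hmirror_le : ∀ d : ℕ, ∀ c : Fin n, c ≤ c.rev → c.rev.val ≤ c.val + d →
      signedPerm 1 (mirrorSign c) ∈ K := by
    intro d
    induction d using Nat.strong_induction_on with
    | _ d ih =>
      intro c hc hd
      by_cases h2 : c.rev.val ≤ c.val + 2
      · exact hcentral c hc h2
      have hr := Fin.val_rev c
      let j : Fin n := ⟨c.val + 1, by omega⟩
      have hrj : j.rev.val = n - (c.val + 1 + 1) := Fin.val_rev j
      obtain ⟨τ, δ, hτ, h1, h3, -⟩ := hlow c j (Fin.lt_def.2 (Nat.lt_succ_self _))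
        (Fin.le_def.2 (by change c.val + 1 ≤ _; omega))
        (fun h => by have := congrArg Fin.val h; change c.val + 1 = _ at this; omega)
      have hj := ih (d - 2) (by omega) j (Fin.le_def.2 (by change c.val + 1 ≤ _; omega))
        (by change _ ≤ c.val + 1 + _; omega)
      have hτj : τ j = c := by
        rw [Fin.le_def] at h1
        rw [Fin.lt_def] at h3
        change _ < c.val + 1 at h3
        exact Fin.ext (by omega)
      have := K.mul_mem (K.mul_mem hτ hj) (K.inv_mem hτ)
      rwa [mirrorSign_conj (mem_fixedGroup_theta_signedPerm.1 (hK hτ)).1, hτj] at this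
  have hmirror (c : Fin n) : signedPerm 1 (mirrorSign c) ∈ K := by
    rcases le_total c c.rev with h | h
    · exact hmirror_le n c h (by omega)
    · have := hmirror_le n c.rev (by simpa using h) (by rw [Fin.rev_rev]; omega)
      have h' : mirrorSign c.rev = mirrorSign c := by
        ext i
        simp [mirrorSign, or_comm]
      rwa [h'] at this
  -- Lexicographic induction: `d` counts the indices not yet known to be fixed, and `v` is the image
  -- of the first of them. When no index is left, `v` is unconstrained.
  suffices H : ∀ d m v : ℕ, m + d = n → ∀ σ ε,
      signedPerm σ ε ∈ fixedGroup (theta (signedPerm 1 s)) → (∀ i : Fin n, i.val < m → σ i = i) →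
      (∀ i : Fin n, i.val = m → (σ i).val = v) → signedPerm σ ε ∈ K by
    rcases Nat.eq_zero_or_pos n with rfl | hn
    · exact H 0 0 0 rfl σ ε hg (fun i => i.elim0) (fun i => i.elim0)
    · exact H n 0 (σ ⟨0, hn⟩).val (by simp) σ ε hg (by simp)
        (fun i hi => congrArg (fun x => (σ x).val) (Fin.ext hi))
  intro d
  induction d with
  | zero =>
    intro m v hm σ ε hg hfix _
    obtain rfl : σ = 1 := Equiv.ext fun i => hfix i (by omega)
    refine symmetric_signs_mem hmirror ε fun j => ?_
    simpa using (mem_fixedGroup_theta_signedPerm.1 hg).2 j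
  | succ d ihd =>
    intro m v
    induction v using Nat.strong_induction_on with
    | _ v ihv =>
      intro hm σ ε hg hfix hv
      let c : Fin n := ⟨m, by omega⟩
      have hrev := (mem_fixedGroup_theta_signedPerm.1 hg).1
      by_cases hc : σ c = c
      · have hfix' (i : Fin n) (hi : i.val < m + 1) : σ i = i := by
          rcases Nat.lt_succ_iff_lt_or_eq.1 hi with hi | hi
          · exact hfix i hi
          · rwa [show i = c from Fin.ext hi]
        by_cases hd : m + 1 < n
        · exact ihd (m + 1) _ (by omega) σ ε hg hfix' (fun i hi =>
            congrArg (fun x => (σ x).val) (Fin.ext hi : i = ⟨m + 1, hd⟩))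
        · exact ihd (m + 1) 0 (by omega) σ ε hg hfix' (fun i hi => by omega)
      · have hge : c < σ c := by
          refine lt_of_le_of_ne (not_lt.1 fun h => hc (σ.injective (hfix (σ c) h))) (Ne.symm hc)
        -- Since σ commutes with the reversal, the positions beyond `c.rev` are occupied too: they
        -- are mirror images of fixed ones.
        have hle : σ c ≤ c.rev := by
          by_contra! h
          have h' : (σ c).rev.val < m := by
            have := Fin.rev_lt_rev.2 h
            rwa [Fin.rev_rev] at this
          have := hfix _ h'
          rw [← hrev] at this
          have := congrArg Fin.rev (σ.injective this)
          rw [Fin.rev_rev, hrev, Fin.rev_rev] at this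
          exact hc this
        have hne : σ c ≠ (σ c).rev := by
          rw [← hrev]
          intro h
          have := σ.injective h
          rw [← this] at hle
          exact absurd hle (not_le.2 hge)
        obtain ⟨τ, δ, hτ, h1, h2, h3⟩ := hlow c (σ c) hge hle hne
        rw [← K.mul_mem_cancel_left hτ]
        rw [signedPerm_mul]
        refine ihv (τ (σ c)).val ?_ hm _ _ ?_ ?_ ?_
        · rw [← hv c rfl]
          exact h2
        · rw [← signedPerm_mul]
          exact mul_mem (hK hτ) hg
        · intro i hi
          rw [Equiv.Perm.mul_apply, hfix i hi, h3 i hi]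
        · intro i hi
          rw [show i = c from Fin.ext hi]
          rfl

/-! ### Matrix exponentials and Tits elements -/

section Exponential

attribute [local instance] Matrix.linftyOpNormedRing Matrix.linftyOpNormedAlgebra

/-- All positive powers of `P` equal `P`, so the series is that of the scalar exponential times `P`,
with a correction `1 - P` in degree 0. -/
theorem exp_smul_of_idempotent {P : Matrix (Fin n) (Fin n) ℂ} (hP : P * P = P) (c : ℂ) :
    NormedSpace.exp (c • P) = 1 + (Complex.exp c - 1) • P := by
  have h := NormedSpace.exp_series_hasSum_exp' (𝕂 := ℂ) (c • P)
  have h₁ := (NormedSpace.exp_series_hasSum_exp' (𝕂 := ℂ) c).smul_const P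
  have h₂ : HasSum (fun k : ℕ => if k = 0 then 1 - P else 0) (1 - P) :=
    hasSum_ite_eq 0 (1 - P)
  have h₃ := h.unique (((h₁.add h₂).congr_fun fun k => ?_))
  · refine h₃.trans ?_
    rw [← Complex.exp_eq_exp_ℂ, sub_smul, one_smul]
    abel
  · rcases k with _ | k
    · simp
    · have : P ^ (k + 1) = P := IsIdempotentElem.pow_succ_eq k hP
      simp [smul_pow, this, smul_smul]

/-- Rodrigues' formula. The matrices `P` and `Q` are the spectral projections of `X` for the
eigenvalues -i and i; they annihilate each other, and the exponential factors over them. -/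
theorem exp_smul_of_cube_eq_neg {X : Matrix (Fin n) (Fin n) ℂ} (hX : X * X * X = -X) (t : ℂ) :
    NormedSpace.exp (t • X) = 1 + Complex.sin t • X + (1 - Complex.cos t) • (X * X) := by
  have h4 : X * X * (X * X) = -(X * X) := by rw [← mul_assoc, hX, neg_mul]
  have h3 : X * (X * X) = -X := by rw [← mul_assoc, hX]
  let P : Matrix (Fin n) (Fin n) ℂ := (-1 / 2 : ℂ) • (X * X) + (Complex.I / 2) • X
  let Q : Matrix (Fin n) (Fin n) ℂ := (-1 / 2 : ℂ) • (X * X) - (Complex.I / 2) • X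
  have hP : P * P = P := by
    simp only [P, add_mul, mul_add, smul_mul_assoc, mul_smul_comm, h4, h3, hX]
    match_scalars <;> ring_nf
    simp
    ring
  have hQ : Q * Q = Q := by
    simp only [Q, sub_mul, mul_sub, smul_mul_assoc, mul_smul_comm, h4, h3, hX]
    match_scalars <;> ring_nf
    simp
    ring
  have hPQ : P * Q = 0 := by
    simp only [P, Q, add_mul, mul_sub, smul_mul_assoc, mul_smul_comm, h4, h3, hX]
    match_scalars <;> ring_nf
    simp
  have hQP : Q * P = 0 := by
    simp only [P, Q, sub_mul, mul_add, smul_mul_assoc, mul_smul_comm, h4, h3, hX]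
    match_scalars <;> ring_nf
    simp
  have hsum : t • X = (-t * Complex.I) • P + (t * Complex.I) • Q := by
    simp only [P, Q, smul_add, smul_sub, smul_smul]
    match_scalars <;> ring_nf
    simp
  have hcomm : Commute ((-t * Complex.I) • P) ((t * Complex.I) • Q) := by
    simp [commute_iff_eq, hPQ, hQP]
  rw [hsum, Matrix.exp_add_of_commute _ _ hcomm, exp_smul_of_idempotent hP,
    exp_smul_of_idempotent hQ]
  simp only [mul_add, add_mul, mul_one, one_mul, smul_mul_assoc, mul_smul_comm, hPQ, smul_zero,
    add_zero]
  rw [Complex.sin, Complex.cos]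
  simp only [P, Q, smul_add, smul_sub, smul_smul]
  match_scalars <;> ring_nf

end Exponential

theorem expGL_add {X Y : Matrix (Fin n) (Fin n) ℂ} (h : Commute X Y) :
    expGL (X + Y) = expGL X * expGL Y :=
  Units.ext (Matrix.exp_add_of_commute X Y h)

theorem titsElement_add {e f e' f' : Matrix (Fin n) (Fin n) ℂ} (h : Commute (f - e) (f' - e')) :
    titsElement (e + e') (f + f') = titsElement e f * titsElement e' f' := by
  rw [titsElement, titsElement, titsElement,
    ← expGL_add ((h.smul_left _).smul_right _), ← smul_add]
  congr 2
  abel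

/-- The Tits element of the root vectors `E_{ab}` and `E_{ba}`. -/
noncomputable def rot (a b : Fin n) : GLn n := titsElement (single a b 1) (single b a 1)

theorem rot_eq {a b : Fin n} (h : a ≠ b) :
    rot a b = signedPerm (Equiv.swap a b) fun j => if j = b then -1 else 1 := by
  have hsq : (single b a (1 : ℂ) - single a b 1) * (single b a 1 - single a b 1) =
      -(single a a 1 + single b b 1) := by
    simp only [sub_mul, mul_sub, single_mul_single_same, single_mul_single_of_ne _ _ _ _ h,
      single_mul_single_of_ne _ _ _ _ h.symm, mul_one]
    abel
  apply Units.ext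
  change NormedSpace.exp (((Real.pi / 2 : ℝ) : ℂ) • (single b a (1 : ℂ) - single a b 1)) = _
  rw [exp_smul_of_cube_eq_neg, hsq]
  · ext i j
    rw [signedPerm_apply]
    have hs : Complex.sin ((Real.pi / 2 : ℝ) : ℂ) = 1 := by
      rw [← Complex.ofReal_sin, Real.sin_pi_div_two, Complex.ofReal_one]
    have hc : Complex.cos ((Real.pi / 2 : ℝ) : ℂ) = 0 := by
      rw [← Complex.ofReal_cos, Real.cos_pi_div_two, Complex.ofReal_zero]
    rw [hs, hc]
    by_cases hja : j = a
    · subst hja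
      simp [Matrix.one_apply, single_apply, h, h.symm, eq_comm]
    by_cases hjb : j = b
    · subst hjb
      simp only [Equiv.swap_apply_right]
      by_cases hi : i = a
      · subst hi
        simp [h, h.symm]
      · by_cases hij : i = j
        · simp [hij, h, h.symm]
        · simp [h, hi, hij, Ne.symm hi, Ne.symm hij]
    simp [Matrix.one_apply, Ne.symm hja, Ne.symm hjb, hja, hjb,
      Equiv.swap_apply_of_ne_of_ne]
  · rw [hsq]
    simp only [neg_mul, add_mul, mul_sub, single_mul_single_same,
      single_mul_single_of_ne _ _ _ _ h, single_mul_single_of_ne _ _ _ _ h.symm, mul_one]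
    abel

theorem titsElement_single_add_single {a b c d : Fin n} (hac : a ≠ c) (had : a ≠ d) (hbc : b ≠ c)
    (hbd : b ≠ d) :
    titsElement (single a b 1 + single c d 1) (single b a 1 + single d c 1) =
      rot a b * rot c d := by
  refine titsElement_add ?_
  simp [commute_iff_eq, sub_mul, mul_sub, single_mul_single_of_ne, hac, had, hbc, hbd, hac.symm,
    had.symm, hbc.symm, hbd.symm]

/-- With A the difference f - e before scaling by √2, A³ = -2A, so X = A/√2 satisfies X³ = -X. The
factor √2 in the root vectors turns the angle π/2 into π, and Rodrigues' formula leaves 1 + 2X² = 1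
+ A². -/
theorem titsElement_short {a b c : Fin n} (hab : a ≠ b) (hbc : b ≠ c) (hac : a ≠ c) :
    titsElement (((Real.sqrt 2 : ℝ) : ℂ) • (single a b 1 + single b c 1))
      (((Real.sqrt 2 : ℝ) : ℂ) • (single b a 1 + single c b 1)) =
      signedPerm (Equiv.swap a c) fun j => if j = b then -1 else 1 := by
  have hr : ((Real.sqrt 2 : ℝ) : ℂ) * ((Real.sqrt 2 : ℝ) : ℂ) = 2 := by
    rw [← Complex.ofReal_mul, Real.mul_self_sqrt (by norm_num)]
    norm_num
  set r : ℂ := ((Real.sqrt 2 : ℝ) : ℂ)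
  let A : Matrix (Fin n) (Fin n) ℂ :=
    single b a 1 + single c b 1 - (single a b 1 + single b c 1)
  have hA : A * A = single c a 1 + single a c 1 - single a a 1 - single c c 1
      - (2 : ℂ) • single b b 1 := by
    simp only [A, sub_mul, mul_sub, add_mul, mul_add, single_mul_single_same,
      single_mul_single_of_ne _ _ _ _ hab, single_mul_single_of_ne _ _ _ _ hab.symm,
      single_mul_single_of_ne _ _ _ _ hbc, single_mul_single_of_ne _ _ _ _ hbc.symm,
      single_mul_single_of_ne _ _ _ _ hac, single_mul_single_of_ne _ _ _ _ hac.symm, mul_one,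
      two_smul]
    abel
  have hA3 : A * A * A = -(2 : ℂ) • A := by
    rw [hA]
    simp only [A, sub_mul, mul_sub, add_mul, mul_add, single_mul_single_same,
      single_mul_single_of_ne _ _ _ _ hab, single_mul_single_of_ne _ _ _ _ hab.symm,
      single_mul_single_of_ne _ _ _ _ hbc, single_mul_single_of_ne _ _ _ _ hbc.symm,
      single_mul_single_of_ne _ _ _ _ hac, single_mul_single_of_ne _ _ _ _ hac.symm, mul_one,
      two_smul, neg_smul]
    abel
  have hX3 : ((r / 2) • A) * ((r / 2) • A) * ((r / 2) • A) = -((r / 2) • A) := by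
    simp only [smul_mul_assoc, mul_smul_comm, hA3, smul_smul, ← neg_smul]
    congr 1
    linear_combination (-r / 4) * hr
  apply Units.ext
  have harg : ((Real.pi / 2 : ℝ) : ℂ) • (r • (single b a 1 + single c b 1) -
      r • (single a b 1 + single b c 1)) = ((Real.pi : ℝ) : ℂ) • ((r / 2) • A) := by
    rw [← smul_sub, smul_smul, smul_smul]
    congr 1
    push_cast
    ring
  change NormedSpace.exp (((Real.pi / 2 : ℝ) : ℂ) • (r • (single b a (1 : ℂ) + single c b 1) -
      r • (single a b 1 + single b c 1))) = _
  rw [harg, exp_smul_of_cube_eq_neg hX3, Complex.sin_pi, Complex.cos_pi]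
  have hsc : (1 - (-1) : ℂ) • (((r / 2) • A) * ((r / 2) • A)) = A * A := by
    simp only [smul_mul_assoc, mul_smul_comm, smul_smul]
    rw [show (1 - (-1) : ℂ) * (r / 2 * (r / 2)) = 1 by linear_combination hr / 2, one_smul]
  rw [hsc, hA]
  ext i j
  rw [signedPerm_apply]
  by_cases hja : j = a
  · subst hja
    simp [Matrix.one_apply, single_apply, hab, hab.symm, hac.symm, eq_comm]
  by_cases hjb : j = b
  · subst hjb
    rw [Equiv.swap_apply_of_ne_of_ne hab.symm hbc]
    by_cases hij : i = j
    · subst hij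
      simp [hab, hbc.symm]
      norm_num
    · simp [hab, hbc.symm, hij, Ne.symm hij]
  by_cases hjc : j = c
  · subst hjc
    simp [Matrix.one_apply, single_apply, hac, hbc, hbc.symm, eq_comm]
  simp [Matrix.one_apply, Ne.symm hja, Ne.symm hjb, Ne.symm hjc, hjb,
    Equiv.swap_apply_of_ne_of_ne hja hjc]

/-! ### Relations between the quarter turns -/

theorem matUnit_eq (a b : Fin n) : matUnit n (a.val + 1) (b.val + 1) = single a b 1 := by
  ext i j
  simp [matUnit, single_apply, Fin.ext_iff, eq_comm]

theorem matUnit_eq_single {i j : ℕ} (a b : Fin n) (hi : i = a.val + 1) (hj : j = b.val + 1) :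
    matUnit n i j = single a b 1 := by
  rw [hi, hj, matUnit_eq]

theorem dotA_eq_rot {i : ℕ} (a b : Fin n) (ha : i = a.val + 1) (hb : i = b.val) :
    dotA n i = rot a b := by
  rw [dotA, eA, fA, rot, matUnit_eq_single a b ha (by rw [hb]),
    matUnit_eq_single b a (by rw [hb]) ha]

theorem rot_mul_rot {a b c d : Fin n} (hab : a ≠ b) (hcd : c ≠ d) (hac : a ≠ c) (had : a ≠ d)
    (hbc : b ≠ c) (hbd : b ≠ d) :
    rot a b * rot c d = signedPerm (Equiv.swap a b * Equiv.swap c d)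
      fun j => if j = b ∨ j = d then -1 else 1 := by
  rw [rot_eq hab, rot_eq hcd, signedPerm_mul, signedPerm_inj]
  refine ⟨rfl, funext fun j => ?_⟩
  by_cases hjc : j = c
  · subst hjc
    simp [hbd.symm, hcd, hbc.symm]
  by_cases hjd : j = d
  · subst hjd
    simp [hbc.symm]
  simp [Equiv.swap_apply_of_ne_of_ne hjc hjd, hjd]

theorem rot_mul_rot_comm {a b c d : Fin n} (hab : a ≠ b) (hcd : c ≠ d) (hac : a ≠ c)
    (had : a ≠ d) (hbc : b ≠ c) (hbd : b ≠ d) : rot a b * rot c d = rot c d * rot a b := by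
  rw [rot_mul_rot hab hcd hac had hbc hbd,
    rot_mul_rot hcd hab hac.symm hbc.symm had.symm hbd.symm, signedPerm_inj]
  refine ⟨Equiv.Perm.Disjoint.commute fun j => ?_, funext fun j => by simp [or_comm]⟩
  by_cases ha : j = a
  · right; rw [ha, Equiv.swap_apply_of_ne_of_ne hac had]
  by_cases hb : j = b
  · right; rw [hb, Equiv.swap_apply_of_ne_of_ne hbc hbd]
  · left; exact Equiv.swap_apply_of_ne_of_ne ha hb

theorem rot_braid {a b c : Fin n} (hab : a ≠ b) (hbc : b ≠ c) (hac : a ≠ c) :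
    signedPerm (Equiv.swap a c) (fun j => if j = b then -1 else 1) = rot a b * rot b c * rot a b ∧
    signedPerm (Equiv.swap a c) (fun j => if j = b then -1 else 1) =
      rot b c * rot a b * rot b c := by
  rw [rot_eq hab, rot_eq hbc]
  simp only [signedPerm_mul, signedPerm_inj]
  refine ⟨⟨Equiv.ext fun j => ?_, funext fun j => ?_⟩, Equiv.ext fun j => ?_, funext fun j => ?_⟩
  all_goals
    have hsq : (-1 : ℤˣ) * -1 = 1 := rfl
    grind [Equiv.Perm.mul_apply, Equiv.Perm.one_apply]

/-- Conjugation by `rot b c` sends the line of `b` to that of `c`, and that of `c` to that of `b`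
with a minus sign. It thus turns `rot a b` into `rot a c` but `rot c d` into the inverse of `rot b
d`, which is why an inverse appears. -/
theorem rot_mul_rot_eq_conj {a b c d : Fin n} (hab : a ≠ b) (hac : a ≠ c) (had : a ≠ d)
    (hbc : b ≠ c) (hbd : b ≠ d) (hcd : c ≠ d) :
    rot a c * rot b d = rot b c * rot a b * (rot c d)⁻¹ * (rot b c)⁻¹ := by
  rw [eq_mul_inv_iff_mul_eq, eq_mul_inv_iff_mul_eq, rot_eq hac, rot_eq hbd, rot_eq hbc,
    rot_eq hcd, rot_eq hab]
  simp only [signedPerm_mul, signedPerm_inj]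
  refine ⟨Equiv.ext fun j => ?_, funext fun j => ?_⟩
  all_goals
    have hsq : (-1 : ℤˣ) * -1 = 1 := rfl
    grind [Equiv.Perm.mul_apply, Equiv.Perm.one_apply]

theorem rot_mul_rot_eq_signs_mul {a b c d : Fin n} (hab : a ≠ b) (hac : a ≠ c) (had : a ≠ d)
    (hbc : b ≠ c) (hbd : b ≠ d) (hcd : c ≠ d) :
    rot a c * rot b d = signedPerm 1 (fun j => if j = a then -1 else 1) *
      signedPerm 1 (fun j => if j = b then -1 else 1) *
      (rot b c * rot a b * rot c d * rot b c) := by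
  rw [rot_eq hac, rot_eq hbd, rot_eq hbc, rot_eq hcd, rot_eq hab]
  simp only [signedPerm_mul, signedPerm_inj]
  refine ⟨Equiv.ext fun j => ?_, funext fun j => ?_⟩
  all_goals
    have hsq : (-1 : ℤˣ) * -1 = 1 := rfl
    grind [Equiv.Perm.mul_apply, Equiv.Perm.one_apply]

/-! ### Fixed elements and the generation criterion -/

theorem swap_mirror_apply_rev (a j : Fin n) :
    Equiv.swap a a.rev j.rev = (Equiv.swap a a.rev j).rev := by
  grind [Fin.rev_rev]

/-- A signed transposition of two mirror images lies in the fixed group of `θ`. -/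
theorem signedPerm_swap_rev_mem {s : Fin n → ℤˣ} {a : Fin n} {ε : Fin n → ℤˣ}
    (ha : ε a * ε a.rev = s a * s a.rev) (hε : ∀ j, j ≠ a → j ≠ a.rev → ε j = ε j.rev) :
    signedPerm (Equiv.swap a a.rev) ε ∈ fixedGroup (theta (signedPerm 1 s)) := by
  rw [mem_fixedGroup_theta_signedPerm]
  refine ⟨swap_mirror_apply_rev a, fun j => ?_⟩
  by_cases h1 : j = a
  · rw [h1, Equiv.swap_apply_left, mul_comm (s a.rev), ← ha, mul_comm (ε a), ← mul_assoc,
      Int.units_mul_self, one_mul]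
  by_cases h2 : j = a.rev
  · rw [h2, Equiv.swap_apply_right, Fin.rev_rev, ← ha, ← mul_assoc, Int.units_mul_self, one_mul]
  · rw [Equiv.swap_apply_of_ne_of_ne h1 h2, Int.units_mul_self, mul_one, hε j h1 h2]

/-- The product of the Tits elements at two mirror images lies in the fixed group of `θ`. -/
theorem rot_mul_rot_rev_mem {s : Fin n → ℤˣ} {a b : Fin n} (hab : a ≠ b) (ha : a ≠ a.rev)
    (hb : b ≠ b.rev) (har : a ≠ b.rev) (h₁ : s a * s b = -1) (h₂ : s a.rev * s b.rev = -1) :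
    rot a b * rot b.rev a.rev ∈ fixedGroup (theta (signedPerm 1 s)) := by
  have hbr : b ≠ a.rev := fun h => har (by rw [h, Fin.rev_rev])
  have habr : a.rev ≠ b.rev := fun h => hab (Fin.rev_injective h)
  rw [rot_mul_rot hab habr.symm har ha hb hbr, mem_fixedGroup_theta_signedPerm]
  constructor
  · intro j
    grind [Equiv.Perm.mul_apply, Fin.rev_rev]
  · intro j
    have hs (x : Fin n) : s x * s x = 1 := Int.units_mul_self _
    -- The sign rule needs `h₁` at `a` and `b` and `h₂` at their mirror images; elsewhere it is
    -- trivial. Conceptually, θ exchanges the two commuting factors.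
    grind [Equiv.Perm.mul_apply, Fin.rev_rev, mul_comm]

/-- A subgroup of the fixed group of `θ` contains the fixed points of the Tits group of `GL_n`
if it contains the mirror pairs of Tits elements, a signed transposition of the two
central lines, and the central mirror signs. -/
theorem titsGL_inf_fixedGroup_le {K : Subgroup (GLn n)} {s : Fin n → ℤˣ}
    (hK : K ≤ fixedGroup (theta (signedPerm 1 s)))
    (hpair : ∀ a b : Fin n, b.val = a.val + 1 → b < b.rev → rot a b * rot b.rev a.rev ∈ K)
    (hmid : ∀ c : Fin n, c < c.rev → c.rev.val ≤ c.val + 2 →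
      ∃ δ, signedPerm (Equiv.swap c c.rev) δ ∈ K)
    (hcentral : ∀ c : Fin n, c ≤ c.rev → c.rev.val ≤ c.val + 2 →
      signedPerm 1 (mirrorSign c) ∈ K) :
    titsGL n ⊓ fixedGroup (theta (signedPerm 1 s)) ≤ K := by
  rintro g ⟨hg, hgG⟩
  obtain ⟨σ, ε, rfl⟩ : ∃ σ ε, g = signedPerm σ ε := by
    refine exists_signedPerm_of_mem_closure ?_ hg
    rintro x (⟨k, ⟨hk₁, hk₂⟩, rfl⟩ | hx)
    · have := dotA_eq_rot (n := n) (i := k) ⟨k - 1, by omega⟩ ⟨k, by omega⟩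
        (by change k = k - 1 + 1; omega) rfl
      exact ⟨_, _, this.trans (rot_eq (by simp [Fin.ext_iff]; omega))⟩
    · obtain ⟨ε, rfl⟩ := exists_signedPerm_of_mem_twoTorsion hx
      exact ⟨_, _, rfl⟩
  refine signedPerm_mem_of_lowering hK ?_ hcentral hgG
  intro m j hmj hjm hj
  have hr := Fin.val_rev j
  have hm := Fin.val_rev m
  rw [Fin.lt_def] at hmj
  rw [Fin.le_def] at hjm
  have hj' : j.val ≠ j.rev.val := fun h => hj (Fin.ext h)
  -- In the front half the mirror pair through `j - 1` and `j` lowers `j` by one. In the back half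
  -- the same works unless `j` is next to the centre, where the central swap carries it to its
  -- mirror image.
  rcases lt_or_gt_of_ne hj' with h | h
  · let a : Fin n := ⟨j.val - 1, by omega⟩
    have hav : a.val = j.val - 1 := rfl
    have har := Fin.val_rev a
    have hp := hpair a j (by omega) h
    rw [rot_mul_rot (by omega) (by omega) (by omega) (by omega) (by omega) (by omega)] at hp
    have hτ : (Equiv.swap a j * Equiv.swap j.rev a.rev) j = a := by
      rw [Equiv.Perm.mul_apply, Equiv.swap_apply_of_ne_of_ne (a := j.rev) (by omega) (by omega),
        Equiv.swap_apply_right]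
    refine ⟨_, _, hp, ?_, ?_, fun i hi => ?_⟩
    · rw [hτ, Fin.le_def]; omega
    · rw [hτ, Fin.lt_def]; omega
    · rw [Fin.lt_def] at hi
      rw [Equiv.Perm.mul_apply, Equiv.swap_apply_of_ne_of_ne (a := j.rev) (by omega) (by omega),
        Equiv.swap_apply_of_ne_of_ne (by omega) (by omega)]
  · by_cases h2 : j.val ≤ j.rev.val + 2
    · obtain ⟨δ, hδ⟩ := hmid j.rev (by rwa [Fin.rev_rev]) (by rwa [Fin.rev_rev])
      rw [Fin.rev_rev] at hδ
      refine ⟨_, _, hδ, ?_, ?_, fun i hi => ?_⟩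
      · rw [Equiv.swap_apply_right, Fin.le_def]; omega
      · rwa [Equiv.swap_apply_right]
      · rw [Fin.lt_def] at hi
        rw [Equiv.swap_apply_of_ne_of_ne (by omega) (by omega)]
    · let a : Fin n := ⟨j.val - 1, by omega⟩
      have hav : a.val = j.val - 1 := rfl
      have har := Fin.val_rev a
      have hp := hpair j.rev a.rev (by omega) (by rw [Fin.rev_rev, Fin.lt_def]; omega)
      simp only [Fin.rev_rev] at hp
      rw [rot_mul_rot (by omega) (by omega) (by omega) (by omega) (by omega) (by omega)] at hp
      have hτ : (Equiv.swap j.rev a.rev * Equiv.swap a j) j = a := by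
        rw [Equiv.Perm.mul_apply, Equiv.swap_apply_right,
          Equiv.swap_apply_of_ne_of_ne (by omega) (by omega)]
      refine ⟨_, _, hp, ?_, ?_, fun i hi => ?_⟩
      · rw [hτ, Fin.le_def]; omega
      · rw [hτ, Fin.lt_def]; omega
      · rw [Fin.lt_def] at hi
        rw [Equiv.Perm.mul_apply, Equiv.swap_apply_of_ne_of_ne (a := a) (by omega) (by omega),
          Equiv.swap_apply_of_ne_of_ne (by omega) (by omega)]

/-! ### Membership in Tits groups -/

theorem dotA_mem_titsGL {k : ℕ} (h₁ : 1 ≤ k) (h₂ : k < n) : dotA n k ∈ titsGL n :=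
  Subgroup.subset_closure (Or.inl ⟨k, ⟨h₁, by omega⟩, rfl⟩)

theorem signedPerm_one_mem_titsGL (ε : Fin n → ℤˣ) : signedPerm 1 ε ∈ titsGL n :=
  Subgroup.subset_closure (Or.inr (signedPerm_one_mem_twoTorsion ε))

theorem titsGroup_le_titsGL_inf {G : Subgroup (GLn n)} {r : ℕ}
    {e f : ℕ → Matrix (Fin n) (Fin n) ℂ}
    (h : ∀ k, 1 ≤ k → k ≤ r → titsElement (e k) (f k) ∈ titsGL n ⊓ G) :
    titsGroup (torus n ⊓ G) r e f ≤ titsGL n ⊓ G := by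
  rw [titsGroup, Subgroup.closure_le]
  rintro x (⟨k, ⟨hk₁, hk₂⟩, rfl⟩ | ⟨⟨hx, hxG⟩, h2⟩)
  · exact h k hk₁ hk₂
  · exact ⟨Subgroup.subset_closure (Or.inr ⟨hx, h2⟩), hxG⟩

theorem titsElement_mem_titsGroup {H : Subgroup (GLn n)} {r : ℕ}
    (e f : ℕ → Matrix (Fin n) (Fin n) ℂ) {k : ℕ} (h₁ : 1 ≤ k) (h₂ : k ≤ r) :
    titsElement (e k) (f k) ∈ titsGroup H r e f :=
  Subgroup.subset_closure (Or.inl ⟨k, ⟨h₁, h₂⟩, rfl⟩)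

theorem neg_one_pow_mul_succ (x : ℕ) : (-1 : ℤˣ) ^ x * (-1) ^ (x + 1) = -1 := by
  rw [pow_succ, ← mul_assoc, Int.units_mul_self, one_mul]

theorem neg_one_pow_succ_mul (x : ℕ) : (-1 : ℤˣ) ^ (x + 1) * (-1) ^ x = -1 := by
  rw [mul_comm, neg_one_pow_mul_succ]

theorem tA_eq_of_val {k : ℕ} (c : Fin n) (hk : k = c.val + 1) :
    tA n k = signedPerm 1 fun j => if j = c then -1 else 1 := by
  subst hk
  simp [tA_eq, Fin.ext_iff]

theorem tA_mul_tA_eq {k m : ℕ} (c : Fin n) (hk : k = c.val + 1) (hm : m = c.rev.val + 1)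
    (hc : c ≠ c.rev) : tA n k * tA n m = signedPerm 1 (mirrorSign c) := by
  rw [tA_eq_of_val c hk, tA_eq_of_val c.rev hm, signedPerm_mul, signedPerm_inj]
  refine ⟨rfl, funext fun j => ?_⟩
  have hsq : (-1 : ℤˣ) * -1 = 1 := rfl
  grind [mirrorSign, Equiv.Perm.one_apply]

theorem tA_eq_mirrorSign {k : ℕ} (c : Fin n) (hk : k = c.val + 1) (hc : c = c.rev) :
    tA n k = signedPerm 1 (mirrorSign c) := by
  rw [tA_eq_of_val c hk, signedPerm_inj]
  refine ⟨rfl, funext fun j => ?_⟩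
  simp [mirrorSign, ← hc]

/-- In type C this produces the central mirror sign from a Tits element, so no torsion generator is
needed there. -/
theorem rot_mul_self {c : Fin n} (hc : c ≠ c.rev) :
    rot c c.rev * rot c c.rev = signedPerm 1 (mirrorSign c) := by
  rw [rot_eq hc, signedPerm_mul, signedPerm_inj]
  refine ⟨Equiv.swap_mul_self _ _, funext fun j => ?_⟩
  grind [mirrorSign]

theorem mirrorSign_rev (c j : Fin n) : mirrorSign c j.rev = mirrorSign c j := by
  simp [mirrorSign, Fin.rev_eq_iff, or_comm]

theorem symmetric_signs_mem_twoTorsion {s ε : Fin n → ℤˣ} (hε : ∀ j, ε j = ε j.rev) :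
    signedPerm 1 ε ∈ twoTorsion (torus n ⊓ fixedGroup (theta (signedPerm 1 s))) := by
  obtain ⟨h₁, h₂⟩ := signedPerm_one_mem_twoTorsion ε
  refine ⟨⟨h₁, mem_fixedGroup_theta_signedPerm.2 ⟨fun j => rfl, fun j => ?_⟩⟩, h₂⟩
  simpa using hε j

theorem mirrorSign_mem_titsGroup {s : Fin n → ℤˣ} {r : ℕ} {e f : ℕ → Matrix (Fin n) (Fin n) ℂ}
    (c : Fin n) :
    signedPerm 1 (mirrorSign c) ∈
      titsGroup (torus n ⊓ fixedGroup (theta (signedPerm 1 s))) r e f :=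
  Subgroup.subset_closure (Or.inr (symmetric_signs_mem_twoTorsion fun j =>
    (mirrorSign_rev c j).symm))

/-! ### Type B -/

theorem groupB_eq (ℓ : ℕ) :
    groupB ℓ = fixedGroup (theta (signedPerm 1 fun a => (-1) ^ a.val)) := by
  rw [groupB, alternatingGL_eq]

theorem dotB_one_eq {ℓ : ℕ} (a b c : Fin (2 * ℓ + 1)) (ha : ℓ = a.val + 1) (hb : ℓ = b.val)
    (hc : ℓ + 1 = c.val) :
    dotB ℓ 1 = signedPerm (Equiv.swap a c) fun j => if j = b then -1 else 1 := by
  rw [dotB, eB, fB, if_pos rfl, if_pos rfl, matUnit_eq_single a b ha (by omega),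
    matUnit_eq_single b c (by omega) (by omega), matUnit_eq_single b a (by omega) ha,
    matUnit_eq_single c b (by omega) (by omega),
    titsElement_short (by omega) (by omega) (by omega)]

theorem dotB_eq {ℓ k : ℕ} (hk : 1 < k) (a b c d : Fin (2 * ℓ + 1)) (ha : ℓ = a.val + k)
    (hb : ℓ + 1 = b.val + k) (hc : ℓ + k = c.val + 1) (hd : ℓ + k = d.val) :
    dotB ℓ k = rot a b * rot c d := by
  rw [dotB, eB, fB, if_neg (by omega), if_neg (by omega),
    matUnit_eq_single a b (by omega) (by omega), matUnit_eq_single c d (by omega) (by omega),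
    matUnit_eq_single b a (by omega) (by omega), matUnit_eq_single d c (by omega) (by omega),
    titsElement_single_add_single (by omega) (by omega) (by omega) (by omega)]

theorem dotB_one_braid {ℓ : ℕ} (hℓ : 1 ≤ ℓ) :
    dotB ℓ 1 = dotA (2 * ℓ + 1) ℓ * dotA (2 * ℓ + 1) (ℓ + 1) * dotA (2 * ℓ + 1) ℓ ∧
    dotB ℓ 1 = dotA (2 * ℓ + 1) (ℓ + 1) * dotA (2 * ℓ + 1) ℓ * dotA (2 * ℓ + 1) (ℓ + 1) := by
  obtain ⟨m, rfl⟩ : ∃ m, ℓ = m + 1 := ⟨ℓ - 1, by omega⟩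
  let a : Fin (2 * (m + 1) + 1) := ⟨m, by omega⟩
  let b : Fin (2 * (m + 1) + 1) := ⟨m + 1, by omega⟩
  let c : Fin (2 * (m + 1) + 1) := ⟨m + 2, by omega⟩
  rw [dotA_eq_rot a b rfl rfl, dotA_eq_rot b c rfl rfl, dotB_one_eq a b c rfl rfl rfl]
  exact rot_braid (by simp [a, b]) (by simp [b, c]) (by simp [a, c])

theorem dotB_eq_dotA_mul {ℓ k : ℕ} (hk : 1 < k) (hkℓ : k ≤ ℓ) :
    dotB ℓ k = dotA (2 * ℓ + 1) (ℓ + 1 - k) * dotA (2 * ℓ + 1) (ℓ + k) ∧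
    dotB ℓ k = dotA (2 * ℓ + 1) (ℓ + k) * dotA (2 * ℓ + 1) (ℓ + 1 - k) := by
  obtain ⟨a, ha⟩ : ∃ a : Fin (2 * ℓ + 1), a.val = ℓ - k := ⟨⟨ℓ - k, by omega⟩, rfl⟩
  obtain ⟨b, hb⟩ : ∃ b : Fin (2 * ℓ + 1), b.val = ℓ + 1 - k := ⟨⟨ℓ + 1 - k, by omega⟩, rfl⟩
  obtain ⟨c, hc⟩ : ∃ c : Fin (2 * ℓ + 1), c.val = ℓ + k - 1 := ⟨⟨ℓ + k - 1, by omega⟩, rfl⟩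
  obtain ⟨d, hd⟩ : ∃ d : Fin (2 * ℓ + 1), d.val = ℓ + k := ⟨⟨ℓ + k, by omega⟩, rfl⟩
  rw [dotA_eq_rot a b (by omega) (by omega), dotA_eq_rot c d (by omega) (by omega),
    dotB_eq hk a b c d (by omega) (by omega) (by omega) (by omega)]
  exact ⟨rfl, rot_mul_rot_comm (by omega) (by omega) (by omega) (by omega) (by omega) (by omega)⟩

theorem dotB_mem {ℓ k : ℕ} (hk : 1 ≤ k) (hkℓ : k ≤ ℓ) :
    dotB ℓ k ∈ titsGL (2 * ℓ + 1) ⊓ groupB ℓ := by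
  rw [groupB_eq]
  rcases hk.eq_or_lt with rfl | hk
  · refine ⟨?_, ?_⟩
    · rw [(dotB_one_braid hkℓ).1]
      exact mul_mem (mul_mem (dotA_mem_titsGL hkℓ (by omega))
        (dotA_mem_titsGL (by omega) (by omega))) (dotA_mem_titsGL hkℓ (by omega))
    · obtain ⟨m, rfl⟩ : ∃ m, ℓ = m + 1 := ⟨ℓ - 1, by omega⟩
      let a : Fin (2 * (m + 1) + 1) := ⟨m, by omega⟩
      have har : a.rev.val = m + 2 := by rw [Fin.val_rev]; change _ - (m + 1) = _; omega
      let b : Fin (2 * (m + 1) + 1) := ⟨m + 1, by omega⟩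
      have hbr : b.rev = b := Fin.ext (by rw [Fin.val_rev]; change _ - (m + 1 + 1) = m + 1; omega)
      rw [dotB_one_eq a b a.rev rfl rfl (by omega)]
      have hav : a.val = m := rfl
      have hbv : b.val = m + 1 := rfl
      refine signedPerm_swap_rev_mem ?_ fun j _ _ => ?_
      -- The exchanged positions differ by 2, so their alternating signs agree.
      · rw [if_neg (by omega), if_neg (by omega), har, hav, ← pow_add,
          Even.neg_one_pow ⟨m + 1, by omega⟩, one_mul]
      · simp [Fin.rev_eq_iff, hbr]
  · refine ⟨?_, ?_⟩
    · rw [(dotB_eq_dotA_mul hk hkℓ).1]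
      exact mul_mem (dotA_mem_titsGL (by omega) (by omega)) (dotA_mem_titsGL (by omega) (by omega))
    · obtain ⟨a, ha⟩ : ∃ a : Fin (2 * ℓ + 1), a.val = ℓ - k := ⟨⟨ℓ - k, by omega⟩, rfl⟩
      obtain ⟨b, hb⟩ : ∃ b : Fin (2 * ℓ + 1), b.val = ℓ + 1 - k := ⟨⟨ℓ + 1 - k, by omega⟩, rfl⟩
      have har := Fin.val_rev a
      have hbr := Fin.val_rev b
      rw [dotB_eq hk a b b.rev a.rev (by omega) (by omega) (by omega) (by omega)]
      refine rot_mul_rot_rev_mem (by omega) (by omega) (by omega) (by omega) ?_ ?_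
      · rw [show b.val = a.val + 1 by omega, neg_one_pow_mul_succ]
      · rw [show a.rev.val = b.rev.val + 1 by omega, neg_one_pow_succ_mul]

theorem titsB_le {ℓ : ℕ} : titsB ℓ ≤ titsGL (2 * ℓ + 1) ⊓ groupB ℓ :=
  titsGroup_le_titsGL_inf fun _ h₁ h₂ => dotB_mem h₁ h₂

/-- The small generating set of the Tits group of `O_{2ℓ+1}`. -/
abbrev generatorsB (ℓ : ℕ) : Set (GLn (2 * ℓ + 1)) :=
  dotB ℓ '' Set.Icc 1 ℓ ∪ {tA (2 * ℓ + 1) (ℓ + 1), tA (2 * ℓ + 1) ℓ * tA (2 * ℓ + 1) (ℓ + 2)}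

theorem closure_generatorsB_le {ℓ : ℕ} (hℓ : 1 ≤ ℓ) :
    Subgroup.closure (generatorsB ℓ) ≤ titsB ℓ := by
  rw [Subgroup.closure_le]
  rintro x (⟨k, ⟨hk₁, hk₂⟩, rfl⟩ | rfl | rfl)
  · exact titsElement_mem_titsGroup _ _ hk₁ hk₂
  · obtain ⟨c, hc⟩ : ∃ c : Fin (2 * ℓ + 1), c.val = ℓ := ⟨⟨ℓ, by omega⟩, rfl⟩
    have hcr := Fin.val_rev c
    rw [tA_eq_mirrorSign c (by omega) (by omega), titsB, groupB_eq]
    exact mirrorSign_mem_titsGroup _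
  · obtain ⟨c, hc⟩ : ∃ c : Fin (2 * ℓ + 1), c.val = ℓ - 1 := ⟨⟨ℓ - 1, by omega⟩, rfl⟩
    have hcr := Fin.val_rev c
    rw [tA_mul_tA_eq c (by omega) (by omega) (by omega), titsB, groupB_eq]
    exact mirrorSign_mem_titsGroup _

theorem titsGL_inf_groupB_le {ℓ : ℕ} (hℓ : 1 ≤ ℓ) :
    titsGL (2 * ℓ + 1) ⊓ groupB ℓ ≤ Subgroup.closure (generatorsB ℓ) := by
  have hK := (closure_generatorsB_le hℓ).trans (titsB_le.trans inf_le_right)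
  have hdot {k} (h₁ : 1 ≤ k) (h₂ : k ≤ ℓ) : dotB ℓ k ∈ Subgroup.closure (generatorsB ℓ) :=
    Subgroup.subset_closure (Or.inl ⟨k, ⟨h₁, h₂⟩, rfl⟩)
  rw [groupB_eq] at hK ⊢
  refine titsGL_inf_fixedGroup_le hK (fun a b hab hb => ?_) (fun c hc hc2 => ?_)
    (fun c hc hc2 => ?_)
  · have har := Fin.val_rev a
    have hbr := Fin.val_rev b
    rw [Fin.lt_def] at hb
    rw [← dotB_eq (k := ℓ - a.val) (by omega) a b b.rev a.rev (by omega) (by omega) (by omega)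
      (by omega)]
    exact hdot (by omega) (by omega)
  · have hcr := Fin.val_rev c
    rw [Fin.lt_def] at hc
    refine ⟨fun j => if j = (⟨ℓ, by omega⟩ : Fin (2 * ℓ + 1)) then -1 else 1, ?_⟩
    rw [← dotB_one_eq c ⟨ℓ, by omega⟩ c.rev (by omega) rfl (by omega)]
    exact hdot le_rfl hℓ
  · have hcr := Fin.val_rev c
    rw [Fin.le_def] at hc
    -- In odd size the central condition allows the middle index and its two neighbours; these give
    -- the two torsion generators.
    by_cases h : c.val = c.rev.val
    · rw [← tA_eq_mirrorSign (k := ℓ + 1) c (by omega) (Fin.ext h)]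
      exact Subgroup.subset_closure (Or.inr (Or.inl rfl))
    · rw [← tA_mul_tA_eq (k := ℓ) (m := ℓ + 2) c (by omega) (by omega)
        (fun h' => h (congrArg Fin.val h'))]
      exact Subgroup.subset_closure (Or.inr (Or.inr rfl))

/-! ### Type C -/

theorem groupC_eq (ℓ : ℕ) :
    groupC ℓ = fixedGroup (theta (signedPerm 1 fun a => (-1) ^ a.val)) := by
  rw [groupC, alternatingGL_eq]

theorem dotC_one_eq {ℓ : ℕ} : dotC ℓ 1 = dotA (2 * ℓ) ℓ := rfl

theorem dotC_eq {ℓ k : ℕ} (hk : 1 < k) (a b c d : Fin (2 * ℓ)) (ha : ℓ = a.val + k)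
    (hb : ℓ + 1 = b.val + k) (hc : ℓ + k = c.val + 2) (hd : ℓ + k = d.val + 1) :
    dotC ℓ k = rot a b * rot c d := by
  rw [dotC, eC, fC, if_neg (by omega), if_neg (by omega),
    matUnit_eq_single a b (by omega) (by omega), matUnit_eq_single c d (by omega) (by omega),
    matUnit_eq_single b a (by omega) (by omega), matUnit_eq_single d c (by omega) (by omega),
    titsElement_single_add_single (by omega) (by omega) (by omega) (by omega)]

theorem dotC_eq_dotA_mul {ℓ k : ℕ} (hk : 1 < k) (hkℓ : k ≤ ℓ) :
    dotC ℓ k = dotA (2 * ℓ) (ℓ + 1 - k) * dotA (2 * ℓ) (ℓ + k - 1) ∧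
    dotC ℓ k = dotA (2 * ℓ) (ℓ + k - 1) * dotA (2 * ℓ) (ℓ + 1 - k) := by
  obtain ⟨a, ha⟩ : ∃ a : Fin (2 * ℓ), a.val = ℓ - k := ⟨⟨ℓ - k, by omega⟩, rfl⟩
  obtain ⟨b, hb⟩ : ∃ b : Fin (2 * ℓ), b.val = ℓ + 1 - k := ⟨⟨ℓ + 1 - k, by omega⟩, rfl⟩
  obtain ⟨c, hc⟩ : ∃ c : Fin (2 * ℓ), c.val = ℓ + k - 2 := ⟨⟨ℓ + k - 2, by omega⟩, rfl⟩
  obtain ⟨d, hd⟩ : ∃ d : Fin (2 * ℓ), d.val = ℓ + k - 1 := ⟨⟨ℓ + k - 1, by omega⟩, rfl⟩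
  rw [dotA_eq_rot a b (by omega) (by omega), dotA_eq_rot c d (by omega) (by omega),
    dotC_eq hk a b c d (by omega) (by omega) (by omega) (by omega)]
  exact ⟨rfl, rot_mul_rot_comm (by omega) (by omega) (by omega) (by omega) (by omega) (by omega)⟩

theorem dotC_mem {ℓ k : ℕ} (hk : 1 ≤ k) (hkℓ : k ≤ ℓ) :
    dotC ℓ k ∈ titsGL (2 * ℓ) ⊓ groupC ℓ := by
  rw [groupC_eq]
  rcases hk.eq_or_lt with rfl | hk
  · rw [dotC_one_eq]
    refine ⟨dotA_mem_titsGL hkℓ (by omega), ?_⟩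
    obtain ⟨a, ha⟩ : ∃ a : Fin (2 * ℓ), a.val = ℓ - 1 := ⟨⟨ℓ - 1, by omega⟩, rfl⟩
    have har := Fin.val_rev a
    rw [dotA_eq_rot a a.rev (by omega) (by omega), rot_eq (by omega)]
    refine signedPerm_swap_rev_mem ?_ fun j h₁ h₂ => ?_
    -- The two central positions are adjacent, so their alternating signs differ, matching the
    -- single minus sign of the quarter turn.
    · rw [if_neg (by omega), if_pos rfl, show a.rev.val = a.val + 1 by omega,
        neg_one_pow_mul_succ, one_mul]
    · rw [if_neg h₂, if_neg (fun h => h₁ (Fin.rev_injective h))]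
  · refine ⟨?_, ?_⟩
    · rw [(dotC_eq_dotA_mul hk hkℓ).1]
      exact mul_mem (dotA_mem_titsGL (by omega) (by omega)) (dotA_mem_titsGL (by omega) (by omega))
    · obtain ⟨a, ha⟩ : ∃ a : Fin (2 * ℓ), a.val = ℓ - k := ⟨⟨ℓ - k, by omega⟩, rfl⟩
      obtain ⟨b, hb⟩ : ∃ b : Fin (2 * ℓ), b.val = ℓ + 1 - k := ⟨⟨ℓ + 1 - k, by omega⟩, rfl⟩
      have har := Fin.val_rev a
      have hbr := Fin.val_rev b
      rw [dotC_eq hk a b b.rev a.rev (by omega) (by omega) (by omega) (by omega)]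
      refine rot_mul_rot_rev_mem (by omega) (by omega) (by omega) (by omega) ?_ ?_
      · rw [show b.val = a.val + 1 by omega, neg_one_pow_mul_succ]
      · rw [show a.rev.val = b.rev.val + 1 by omega, neg_one_pow_succ_mul]

theorem titsC_le {ℓ : ℕ} : titsC ℓ ≤ titsGL (2 * ℓ) ⊓ groupC ℓ :=
  titsGroup_le_titsGL_inf fun _ h₁ h₂ => dotC_mem h₁ h₂

theorem closure_dotC_le {ℓ : ℕ} : Subgroup.closure (dotC ℓ '' Set.Icc 1 ℓ) ≤ titsC ℓ := by
  rw [Subgroup.closure_le]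
  rintro x ⟨k, ⟨hk₁, hk₂⟩, rfl⟩
  exact titsElement_mem_titsGroup _ _ hk₁ hk₂

theorem titsGL_inf_groupC_le {ℓ : ℕ} (hℓ : 1 ≤ ℓ) :
    titsGL (2 * ℓ) ⊓ groupC ℓ ≤ Subgroup.closure (dotC ℓ '' Set.Icc 1 ℓ) := by
  have hK := (closure_dotC_le (ℓ := ℓ)).trans (titsC_le.trans inf_le_right)
  have hdot {k} (h₁ : 1 ≤ k) (h₂ : k ≤ ℓ) :
      dotC ℓ k ∈ Subgroup.closure (dotC ℓ '' Set.Icc 1 ℓ) :=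
    Subgroup.subset_closure ⟨k, ⟨h₁, h₂⟩, rfl⟩
  rw [groupC_eq] at hK ⊢
  have hmid (c : Fin (2 * ℓ)) (hc : c.val + 1 = ℓ) : rot c c.rev ∈
      Subgroup.closure (dotC ℓ '' Set.Icc 1 ℓ) := by
    have hcr := Fin.val_rev c
    rw [← dotA_eq_rot (i := ℓ) c c.rev (by omega) (by omega), ← dotC_one_eq]
    exact hdot le_rfl hℓ
  refine titsGL_inf_fixedGroup_le hK (fun a b hab hb => ?_) (fun c hc hc2 => ?_)
    (fun c hc hc2 => ?_)
  · have har := Fin.val_rev a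
    have hbr := Fin.val_rev b
    rw [Fin.lt_def] at hb
    rw [← dotC_eq (k := ℓ - a.val) (by omega) a b b.rev a.rev (by omega) (by omega) (by omega)
      (by omega)]
    exact hdot (by omega) (by omega)
  · have hcr := Fin.val_rev c
    have := hmid c (by rw [Fin.lt_def] at hc; omega)
    rw [rot_eq hc.ne] at this
    exact ⟨_, this⟩
  · have hcr := Fin.val_rev c
    rw [Fin.le_def] at hc
    have hm := hmid c (by omega)
    have := mul_mem hm hm
    rwa [rot_mul_self (by omega)] at this

/-! ### Type D: Tits elements and the diagram symmetry -/

/-- The signs of the matrix `S_D`. -/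
abbrev signD (ℓ : ℕ) (a : Fin (2 * ℓ)) : ℤˣ := (-1) ^ a.val * if a.val < ℓ then 1 else -1

theorem groupD_eq (ℓ : ℕ) : groupD ℓ = fixedGroup (theta (signedPerm 1 (signD ℓ))) := by
  rw [groupD, sD_eq]

theorem signD_mul_of_same {ℓ : ℕ} {a b : Fin (2 * ℓ)} (hab : b.val = a.val + 1)
    (h : a.val < ℓ ↔ b.val < ℓ) : signD ℓ a * signD ℓ b = -1 := by
  simp only [signD, h]
  rw [mul_mul_mul_comm, Int.units_mul_self, mul_one, hab, neg_one_pow_mul_succ]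

/-- The sign jump at the centre makes the two central signs equal, so the unsigned central swap is
fixed by θ, while positions two apart across the centre get opposite signs, as the pair at node 1
requires. -/
theorem signD_mul_of_opposite {ℓ : ℕ} {a b : Fin (2 * ℓ)} (ha : a.val < ℓ) (hb : ¬b.val < ℓ) :
    signD ℓ a * signD ℓ b = -(-1) ^ (a.val + b.val) := by
  simp [signD, ha, hb, pow_add]

theorem eD_one {ℓ : ℕ} (a b c d : Fin (2 * ℓ)) (ha : a.val + 2 = ℓ) (hb : b.val + 1 = ℓ)
    (hc : c.val = ℓ) (hd : d.val = ℓ + 1) : eD ℓ 1 = single a c 1 + single b d 1 := by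
  rw [eD, if_pos rfl, matUnit_eq_single a c (by omega) (by omega),
    matUnit_eq_single b d (by omega) (by omega)]

theorem fD_one {ℓ : ℕ} (a b c d : Fin (2 * ℓ)) (ha : a.val + 2 = ℓ) (hb : b.val + 1 = ℓ)
    (hc : c.val = ℓ) (hd : d.val = ℓ + 1) : fD ℓ 1 = single c a 1 + single d b 1 := by
  rw [fD, if_pos rfl, matUnit_eq_single c a (by omega) (by omega),
    matUnit_eq_single d b (by omega) (by omega)]

theorem eD_eq {ℓ k : ℕ} (hk : 1 < k) (a b c d : Fin (2 * ℓ)) (ha : ℓ = a.val + k)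
    (hb : ℓ + 1 = b.val + k) (hc : ℓ + k = c.val + 2) (hd : ℓ + k = d.val + 1) :
    eD ℓ k = single a b 1 + single c d 1 := by
  rw [eD, if_neg (by omega), matUnit_eq_single a b (by omega) (by omega),
    matUnit_eq_single c d (by omega) (by omega)]

theorem fD_eq {ℓ k : ℕ} (hk : 1 < k) (a b c d : Fin (2 * ℓ)) (ha : ℓ = a.val + k)
    (hb : ℓ + 1 = b.val + k) (hc : ℓ + k = c.val + 2) (hd : ℓ + k = d.val + 1) :
    fD ℓ k = single b a 1 + single d c 1 := by
  rw [fD, if_neg (by omega), matUnit_eq_single b a (by omega) (by omega),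
    matUnit_eq_single d c (by omega) (by omega)]

theorem dotD_one_eq {ℓ : ℕ} (a b c d : Fin (2 * ℓ)) (ha : a.val + 2 = ℓ) (hb : b.val + 1 = ℓ)
    (hc : c.val = ℓ) (hd : d.val = ℓ + 1) : dotD ℓ 1 = rot a c * rot b d := by
  rw [dotD, eD_one a b c d ha hb hc hd, fD_one a b c d ha hb hc hd,
    titsElement_single_add_single (by omega) (by omega) (by omega) (by omega)]

theorem dotD_eq {ℓ k : ℕ} (hk : 1 < k) (a b c d : Fin (2 * ℓ)) (ha : ℓ = a.val + k)
    (hb : ℓ + 1 = b.val + k) (hc : ℓ + k = c.val + 2) (hd : ℓ + k = d.val + 1) :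
    dotD ℓ k = rot a b * rot c d := by
  rw [dotD, eD_eq hk a b c d ha hb hc hd, fD_eq hk a b c d ha hb hc hd,
    titsElement_single_add_single (by omega) (by omega) (by omega) (by omega)]

theorem dotD_eq_dotA_mul {ℓ k : ℕ} (hk : 1 < k) (hkℓ : k ≤ ℓ) :
    dotD ℓ k = dotA (2 * ℓ) (ℓ + 1 - k) * dotA (2 * ℓ) (ℓ + k - 1) ∧
    dotD ℓ k = dotA (2 * ℓ) (ℓ + k - 1) * dotA (2 * ℓ) (ℓ + 1 - k) := by
  obtain ⟨a, ha⟩ : ∃ a : Fin (2 * ℓ), a.val = ℓ - k := ⟨⟨ℓ - k, by omega⟩, rfl⟩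
  obtain ⟨b, hb⟩ : ∃ b : Fin (2 * ℓ), b.val = ℓ + 1 - k := ⟨⟨ℓ + 1 - k, by omega⟩, rfl⟩
  obtain ⟨c, hc⟩ : ∃ c : Fin (2 * ℓ), c.val = ℓ + k - 2 := ⟨⟨ℓ + k - 2, by omega⟩, rfl⟩
  obtain ⟨d, hd⟩ : ∃ d : Fin (2 * ℓ), d.val = ℓ + k - 1 := ⟨⟨ℓ + k - 1, by omega⟩, rfl⟩
  rw [dotA_eq_rot a b (by omega) (by omega), dotA_eq_rot c d (by omega) (by omega),
    dotD_eq hk a b c d (by omega) (by omega) (by omega) (by omega)]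
  exact ⟨rfl, rot_mul_rot_comm (by omega) (by omega) (by omega) (by omega) (by omega) (by omega)⟩

theorem exists_central_indices {ℓ : ℕ} (hℓ : 2 ≤ ℓ) : ∃ a b c d : Fin (2 * ℓ),
    a.val + 2 = ℓ ∧ b.val + 1 = ℓ ∧ c.val = ℓ ∧ d.val = ℓ + 1 :=
  ⟨⟨ℓ - 2, by omega⟩, ⟨ℓ - 1, by omega⟩, ⟨ℓ, by omega⟩, ⟨ℓ + 1, by omega⟩, by
    change ℓ - 2 + 2 = ℓ; omega, by change ℓ - 1 + 1 = ℓ; omega, rfl, rfl⟩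

theorem dotD_one_formulas {ℓ : ℕ} (hℓ : 2 ≤ ℓ) :
    dotD ℓ 1 = dotA (2 * ℓ) ℓ * dotA (2 * ℓ) (ℓ - 1) * (dotA (2 * ℓ) (ℓ + 1))⁻¹ *
      (dotA (2 * ℓ) ℓ)⁻¹ ∧
    dotD ℓ 1 = dotA (2 * ℓ) ℓ * (dotA (2 * ℓ) (ℓ + 1))⁻¹ * dotA (2 * ℓ) (ℓ - 1) *
      (dotA (2 * ℓ) ℓ)⁻¹ ∧
    dotD ℓ 1 = tA (2 * ℓ) (ℓ - 1) * tA (2 * ℓ) ℓ * (dotA (2 * ℓ) ℓ * dotA (2 * ℓ) (ℓ - 1) *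
      dotA (2 * ℓ) (ℓ + 1) * dotA (2 * ℓ) ℓ) := by
  obtain ⟨a, b, c, d, ha, hb, hc, hd⟩ := exists_central_indices hℓ
  have hab : a ≠ b := by omega
  have hac : a ≠ c := by omega
  have had : a ≠ d := by omega
  have hbc : b ≠ c := by omega
  have hbd : b ≠ d := by omega
  have hcd : c ≠ d := by omega
  rw [dotA_eq_rot (i := ℓ) b c (by omega) (by omega), dotA_eq_rot a b (by omega) (by omega),
    dotA_eq_rot c d (by omega) (by omega), dotD_one_eq a b c d ha hb hc hd,
    tA_eq_of_val (k := ℓ - 1) a (by omega), tA_eq_of_val (k := ℓ) b (by omega)]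
  have h₁ := rot_mul_rot_eq_conj hab hac had hbc hbd hcd
  have hcomm : Commute (rot a b) (rot c d) := rot_mul_rot_comm hab hcd hac had hbc hbd
  refine ⟨h₁, ?_, rot_mul_rot_eq_signs_mul hab hac had hbc hbd hcd⟩
  rw [h₁, mul_assoc (rot b c) (rot a b), hcomm.inv_right.eq, ← mul_assoc (rot b c)]

/-- The reflection `T_ℓ` removes the only minus sign of the quarter turn. Conjugation by the result
therefore permutes matrix units without signs. -/
theorem tA_mul_dotA_eq {ℓ : ℕ} (b c : Fin (2 * ℓ)) (hb : b.val + 1 = ℓ) (hc : c.val = ℓ) :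
    tA (2 * ℓ) ℓ * dotA (2 * ℓ) ℓ = signedPerm (Equiv.swap b c) fun _ => 1 := by
  have hbc : b ≠ c := by omega
  rw [tA_eq_of_val b hb.symm, dotA_eq_rot b c hb.symm hc.symm, rot_eq hbc, signedPerm_mul,
    signedPerm_inj]
  refine ⟨one_mul _, funext fun j => ?_⟩
  have hsq : (-1 : ℤˣ) * -1 = 1 := rfl
  grind

theorem tA_mul_dotA_mem_groupD {ℓ : ℕ} (hℓ : 2 ≤ ℓ) :
    tA (2 * ℓ) ℓ * dotA (2 * ℓ) ℓ ∈ groupD ℓ := by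
  obtain ⟨a, b, c, d, ha, hb, hc, hd⟩ := exists_central_indices hℓ
  have hbr := Fin.val_rev b
  obtain rfl : c = b.rev := by omega
  rw [tA_mul_dotA_eq b b.rev hb hc, groupD_eq]
  refine signedPerm_swap_rev_mem ?_ fun _ _ _ => rfl
  rw [signD_mul_of_opposite (by omega) (by omega), Odd.neg_one_pow ⟨b.val, by omega⟩]
  rfl

theorem signedPerm_conj_single (σ : Equiv.Perm (Fin n)) (a b : Fin n) :
    (signedPerm σ fun _ => 1).val * single a b 1 * ((signedPerm σ fun _ => 1)⁻¹).val =
      single (σ a) (σ b) 1 := by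
  rw [Units.mul_inv_eq_iff_eq_mul]
  ext i j
  by_cases hj : j = b
  · subst hj
    by_cases hi : i = σ a
    · subst hi
      simp [signedPerm_apply]
    · simp [signedPerm_apply, hi]
  · by_cases hi : i = σ a
    · subst hi
      simp [signedPerm_apply, hj, Ne.symm hj]
    · simp [hi, hj]

theorem tA_mul_dotA_mem_diagramLiftsD {ℓ : ℕ} (hℓ : 2 ≤ ℓ) :
    tA (2 * ℓ) ℓ * dotA (2 * ℓ) ℓ ∈ diagramLiftsD ℓ := by
  refine ⟨tA_mul_dotA_mem_groupD hℓ, ?_⟩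
  rintro k ⟨hk₁, hk₂⟩
  obtain ⟨a, b, c, d, ha, hb, hc, hd⟩ := exists_central_indices hℓ
  have hab : a ≠ b := by omega
  have hac : a ≠ c := by omega
  have hbd : b ≠ d := by omega
  have hcd : c ≠ d := by omega
  have hsa : Equiv.swap b c a = a := Equiv.swap_apply_of_ne_of_ne hab hac
  have hsd : Equiv.swap b c d = d := Equiv.swap_apply_of_ne_of_ne hbd.symm hcd.symm
  rw [tA_mul_dotA_eq b c hb hc]
  have he₁ := eD_one a b c d ha hb hc hd
  have hf₁ := fD_one a b c d ha hb hc hd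
  have he₂ : eD ℓ 2 = single a b 1 + single c d 1 :=
    eD_eq one_lt_two a b c d (by omega) (by omega) (by omega) (by omega)
  have hf₂ : fD ℓ 2 = single b a 1 + single d c 1 :=
    fD_eq one_lt_two a b c d (by omega) (by omega) (by omega) (by omega)
  rcases hk₁.eq_or_lt with rfl | hk₁
  · rw [Equiv.swap_apply_left, he₁, hf₁, he₂, hf₂]
    simp only [mul_add, add_mul, signedPerm_conj_single, hsa, hsd, Equiv.swap_apply_left,
      Equiv.swap_apply_right, and_self]
  rcases (Nat.succ_le_of_lt hk₁).eq_or_lt with rfl | hk₁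
  · change _ * eD ℓ 2 * _ = eD ℓ (Equiv.swap 1 2 2) ∧ _ * fD ℓ 2 * _ = fD ℓ (Equiv.swap 1 2 2)
    rw [Equiv.swap_apply_right, he₁, hf₁, he₂, hf₂]
    simp only [mul_add, add_mul, signedPerm_conj_single, hsa, hsd, Equiv.swap_apply_left,
      Equiv.swap_apply_right, and_self]
  · rw [Equiv.swap_apply_of_ne_of_ne (by omega) (by omega)]
    obtain ⟨p, hp⟩ : ∃ p : Fin (2 * ℓ), p.val = ℓ - k := ⟨⟨ℓ - k, by omega⟩, rfl⟩
    obtain ⟨q, hq⟩ : ∃ q : Fin (2 * ℓ), q.val = ℓ + 1 - k := ⟨⟨ℓ + 1 - k, by omega⟩, rfl⟩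
    obtain ⟨r, hr⟩ : ∃ r : Fin (2 * ℓ), r.val = ℓ + k - 2 := ⟨⟨ℓ + k - 2, by omega⟩, rfl⟩
    obtain ⟨t, ht⟩ : ∃ t : Fin (2 * ℓ), t.val = ℓ + k - 1 := ⟨⟨ℓ + k - 1, by omega⟩, rfl⟩
    have hfix (x : Fin (2 * ℓ)) (h₁ : x ≠ b) (h₂ : x ≠ c) : Equiv.swap b c x = x :=
      Equiv.swap_apply_of_ne_of_ne h₁ h₂
    rw [eD_eq (by omega) p q r t (by omega) (by omega) (by omega) (by omega),
      fD_eq (by omega) p q r t (by omega) (by omega) (by omega) (by omega)]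
    simp only [mul_add, add_mul, signedPerm_conj_single]
    rw [hfix p (by omega) (by omega), hfix q (by omega) (by omega), hfix r (by omega) (by omega),
      hfix t (by omega) (by omega)]
    exact ⟨rfl, rfl⟩

/-! ### Type D: rigidity of the diagram lifts and generation -/

/-- A matrix that commutes with the simple root vectors of `so_{2ℓ}` is scalar. -/
theorem mem_range_scalar_of_commute {ℓ : ℕ} (hℓ : 2 ≤ ℓ) {M : Matrix (Fin (2 * ℓ)) (Fin (2 * ℓ)) ℂ}
    (he : ∀ k, 1 ≤ k → k ≤ ℓ → Commute M (eD ℓ k))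
    (hf : ∀ k, 1 ≤ k → k ≤ ℓ → Commute M (fD ℓ k)) : M ∈ Set.range (Matrix.scalar (Fin (2 * ℓ))) := by
  obtain ⟨a, b, c, d, ha, hb, hc, hd⟩ := exists_central_indices hℓ
  have hab : a ≠ b := by omega
  have hac : a ≠ c := by omega
  have had : a ≠ d := by omega
  have hbc : b ≠ c := by omega
  have hbd : b ≠ d := by omega
  have hcd : c ≠ d := by omega
  have he₁ := he 1 le_rfl (by omega)
  have hf₁ := hf 1 le_rfl (by omega)
  have he₂ := he 2 (by omega) hℓ
  have hf₂ := hf 2 (by omega) hℓ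
  rw [eD_one a b c d ha hb hc hd] at he₁
  rw [fD_one a b c d ha hb hc hd] at hf₁
  rw [eD_eq one_lt_two a b c d (by omega) (by omega) (by omega) (by omega)] at he₂
  rw [fD_eq one_lt_two a b c d (by omega) (by omega) (by omega) (by omega)] at hf₂
  -- The product e₂f₂e₁f₁ is the matrix unit `E_aa`: e₂f₂ = E_aa + E_cc and e₁f₁ = E_aa + E_bb.
  have haa : Commute M (single a a 1) := by
    have := (he₂.mul_right hf₂).mul_right (he₁.mul_right hf₁)
    simpa [mul_add, add_mul, single_mul_single_of_ne, hab, hac, had, hbc, hbd, hcd, hab.symm,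
      hac.symm, had.symm, hbc.symm, hbd.symm, hcd.symm] using this
  have hcentral (x : Fin (2 * ℓ)) (h₁ : ℓ ≤ x.val + 2) (h₂ : x.val ≤ ℓ + 1) :
      Commute M (single a x 1) ∧ Commute M (single x a 1) := by
    have hx : x = a ∨ x = b ∨ x = c ∨ x = d := by omega
    rcases hx with rfl | rfl | rfl | rfl
    · exact ⟨haa, haa⟩
    · exact ⟨by simpa [mul_add, hac] using haa.mul_right he₂,
        by simpa [add_mul, hac.symm] using hf₂.mul_right haa⟩
    · exact ⟨by simpa [mul_add, hab] using haa.mul_right he₁,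
        by simpa [add_mul, hab.symm] using hf₁.mul_right haa⟩
    · have h₁ := (haa.mul_right he₂).mul_right he₁
      have h₂ := hf₁.mul_right (hf₂.mul_right haa)
      exact ⟨by simpa [mul_add, hac, hab, hab.symm] using h₁,
        by simpa [mul_add, add_mul, hac.symm, hab, hab.symm] using h₂⟩
  -- Multiplying by the root vectors at node `k + 1` extends the central block of reachable indices
  -- by one on each side. Finally E_ij = E_ia E_aj.
  have hall : ∀ k, 2 ≤ k → k ≤ ℓ → ∀ x : Fin (2 * ℓ), ℓ ≤ x.val + k → x.val + 1 ≤ ℓ + k →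
      Commute M (single a x 1) ∧ Commute M (single x a 1) := by
    intro k hk
    induction k, hk using Nat.le_induction with
    | base => exact fun _ x h₁ h₂ => hcentral x h₁ (by omega)
    | succ k hk ih =>
      intro hkℓ x h₁ h₂
      specialize ih (by omega)
      obtain ⟨p, hp⟩ : ∃ p : Fin (2 * ℓ), p.val = ℓ - (k + 1) := ⟨⟨ℓ - (k + 1), by omega⟩, rfl⟩
      obtain ⟨q, hq⟩ : ∃ q : Fin (2 * ℓ), q.val = ℓ - k := ⟨⟨ℓ - k, by omega⟩, rfl⟩
      obtain ⟨r, hr⟩ : ∃ r : Fin (2 * ℓ), r.val = ℓ + k - 1 := ⟨⟨ℓ + k - 1, by omega⟩, rfl⟩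
      obtain ⟨t, ht⟩ : ∃ t : Fin (2 * ℓ), t.val = ℓ + k := ⟨⟨ℓ + k, by omega⟩, rfl⟩
      have hek := he (k + 1) (by omega) hkℓ
      have hfk := hf (k + 1) (by omega) hkℓ
      rw [eD_eq (by omega) p q r t (by omega) (by omega) (by omega) (by omega)] at hek
      rw [fD_eq (by omega) p q r t (by omega) (by omega) (by omega) (by omega)] at hfk
      have hpr : p ≠ r := by omega
      have hqt : q ≠ t := by omega
      have hx : x = p ∨ x = t ∨ (ℓ ≤ x.val + k ∧ x.val + 1 ≤ ℓ + k) := by omega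
      rcases hx with rfl | rfl | ⟨h₁, h₂⟩
      · obtain ⟨hq₁, hq₂⟩ := ih q (by omega) (by omega)
        exact ⟨by simpa [mul_add, hqt] using hq₁.mul_right hfk,
          by simpa [add_mul, hqt.symm] using hek.mul_right hq₂⟩
      · obtain ⟨hr₁, hr₂⟩ := ih r (by omega) (by omega)
        exact ⟨by simpa [mul_add, hpr.symm] using hr₁.mul_right hek,
          by simpa [add_mul, hpr] using hfk.mul_right hr₂⟩
      · exact ih x h₁ h₂
  refine mem_range_scalar_of_commute_single fun i j _ => ?_
  have hi := (hall ℓ hℓ le_rfl i (by omega) (by omega)).2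
  have hj := (hall ℓ hℓ le_rfl j (by omega) (by omega)).1
  simpa using (hi.mul_right hj).symm

/-- The scalar matrices in the fixed group of `θ` are `1` and `-1`. -/
theorem exists_signedPerm_of_scalar {S h : GLn n} (hh : h ∈ fixedGroup (theta S))
    (hs : h.val ∈ Set.range (Matrix.scalar (Fin n))) : ∃ ε, h = signedPerm 1 ε := by
  obtain ⟨z, hz⟩ := hs
  -- A scalar is invariant under τ and commutes with `S`, so θ inverts it; being fixed then forces
  -- its square to be 1.
  have hτ : antiTransposeGL h = h := by
    apply Units.ext
    change antiTranspose h.val = h.val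
    rw [← hz]
    ext i j
    simp [antiTranspose, Matrix.diagonal_apply, eq_comm]
  have hcomm : h⁻¹ * S = S * h⁻¹ := by
    rw [inv_mul_eq_iff_eq_mul, ← mul_assoc, eq_mul_inv_iff_mul_eq]
    apply Units.ext
    rw [Units.val_mul, Units.val_mul, ← hz]
    exact (Matrix.scalar_commute z (fun r => Commute.all z r) S.val).eq.symm
  have hfix : S * (antiTransposeGL h)⁻¹ * S⁻¹ = h := hh
  rw [hτ, ← hcomm, mul_inv_cancel_right] at hfix
  refine exists_signedPerm_of_mem_twoTorsion ⟨?_, ?_⟩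
  · rcases Nat.eq_zero_or_pos n with rfl | hn
    · exact ⟨1, Units.ext (Subsingleton.elim _ _)⟩
    have hz0 : z ≠ 0 := by
      rintro rfl
      have := congrFun (congrFun h.mul_inv ⟨0, hn⟩) ⟨0, hn⟩
      rw [← hz] at this
      simp at this
    refine ⟨fun _ => Units.mk0 z hz0, Units.ext ?_⟩
    rw [← hz]
    rfl
  · nth_rewrite 1 [pow_two, ← hfix]
    exact inv_mul_cancel h

theorem dotD_mem {ℓ k : ℕ} (hℓ : 2 ≤ ℓ) (hk : 1 ≤ k) (hkℓ : k ≤ ℓ) :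
    dotD ℓ k ∈ titsGL (2 * ℓ) ⊓ groupD ℓ := by
  rw [groupD_eq]
  rcases hk.eq_or_lt with rfl | hk
  · refine ⟨?_, ?_⟩
    · change dotD ℓ 1 ∈ titsGL (2 * ℓ)
      rw [(dotD_one_formulas hℓ).1]
      have h₁ : dotA (2 * ℓ) ℓ ∈ titsGL (2 * ℓ) := dotA_mem_titsGL (by omega) (by omega)
      exact mul_mem (mul_mem (mul_mem h₁ (dotA_mem_titsGL (by omega) (by omega)))
        (inv_mem (dotA_mem_titsGL (by omega) (by omega)))) (inv_mem h₁)
    · obtain ⟨a, b, c, d, ha, hb, hc, hd⟩ := exists_central_indices hℓ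
      have har := Fin.val_rev a
      have hcr := Fin.val_rev c
      obtain rfl : b = c.rev := by omega
      obtain rfl : d = a.rev := by omega
      rw [dotD_one_eq a c.rev c a.rev ha hb hc hd]
      refine rot_mul_rot_rev_mem (by omega) (by omega) (by omega) (by omega) ?_ ?_
      · rw [signD_mul_of_opposite (by omega) (by omega), Even.neg_one_pow ⟨a.val + 1, by omega⟩]
      · rw [mul_comm, signD_mul_of_opposite (by omega) (by omega),
          Even.neg_one_pow ⟨ℓ, by omega⟩]
  · refine ⟨?_, ?_⟩
    · rw [(dotD_eq_dotA_mul hk hkℓ).1]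
      exact mul_mem (dotA_mem_titsGL (by omega) (by omega)) (dotA_mem_titsGL (by omega) (by omega))
    · obtain ⟨a, ha⟩ : ∃ a : Fin (2 * ℓ), a.val = ℓ - k := ⟨⟨ℓ - k, by omega⟩, rfl⟩
      obtain ⟨b, hb⟩ : ∃ b : Fin (2 * ℓ), b.val = ℓ + 1 - k := ⟨⟨ℓ + 1 - k, by omega⟩, rfl⟩
      have har := Fin.val_rev a
      have hbr := Fin.val_rev b
      rw [dotD_eq hk a b b.rev a.rev (by omega) (by omega) (by omega) (by omega)]
      refine rot_mul_rot_rev_mem (by omega) (by omega) (by omega) (by omega) ?_ ?_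
      · exact signD_mul_of_same (by omega) (by omega)
      · rw [mul_comm]
        exact signD_mul_of_same (by omega) (by omega)

theorem titsSOeven_le {ℓ : ℕ} (hℓ : 2 ≤ ℓ) : titsSOeven ℓ ≤ titsGL (2 * ℓ) ⊓ groupD ℓ :=
  titsGroup_le_titsGL_inf fun _ h₁ h₂ => dotD_mem hℓ h₁ h₂

theorem tA_mul_dotA_mem {ℓ : ℕ} (hℓ : 2 ≤ ℓ) :
    tA (2 * ℓ) ℓ * dotA (2 * ℓ) ℓ ∈ titsGL (2 * ℓ) ⊓ groupD ℓ := by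
  refine ⟨mul_mem ?_ (dotA_mem_titsGL (by omega) (by omega)), tA_mul_dotA_mem_groupD hℓ⟩
  rw [tA_eq]
  exact signedPerm_one_mem_titsGL _

/-- A lift `g` and the known lift `R` conjugate the root vectors identically, so `R⁻¹ * g` commutes
with all of them. It is then a scalar in the fixed group, hence a diagonal sign matrix. -/
theorem diagramLiftsD_subset {ℓ : ℕ} (hℓ : 2 ≤ ℓ) {g : GLn (2 * ℓ)} (hg : g ∈ diagramLiftsD ℓ) :
    g ∈ titsGL (2 * ℓ) ⊓ groupD ℓ := by
  obtain ⟨hRG, hR⟩ := tA_mul_dotA_mem_diagramLiftsD hℓ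
  have hRmem := tA_mul_dotA_mem hℓ
  obtain ⟨hgG, hg⟩ := hg
  generalize tA (2 * ℓ) ℓ * dotA (2 * ℓ) ℓ = R at hRG hR hRmem
  have hcomm {X Y : Matrix (Fin (2 * ℓ)) (Fin (2 * ℓ)) ℂ} (h₁ : R.val * X * (R⁻¹).val = Y)
      (h₂ : g.val * X * (g⁻¹).val = Y) : Commute (R⁻¹ * g).val X := by
    rw [Units.mul_inv_eq_iff_eq_mul] at h₁ h₂
    rw [commute_iff_eq, Units.val_mul, mul_assoc, h₂, Units.inv_mul_eq_iff_eq_mul, ← mul_assoc,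
      ← mul_assoc, h₁, mul_assoc Y, Units.mul_inv, mul_one]
  have hscalar := mem_range_scalar_of_commute hℓ
    (fun k h₁ h₂ => hcomm (hR k ⟨h₁, h₂⟩).1 (hg k ⟨h₁, h₂⟩).1)
    (fun k h₁ h₂ => hcomm (hR k ⟨h₁, h₂⟩).2 (hg k ⟨h₁, h₂⟩).2)
  have hmem : R⁻¹ * g ∈ groupD ℓ := mul_mem (inv_mem hRG) hgG
  obtain ⟨ε, hε⟩ := exists_signedPerm_of_scalar (S := sD ℓ) hmem hscalar
  refine ⟨?_, hgG⟩
  rw [inv_mul_eq_iff_eq_mul] at hε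
  rw [hε]
  exact mul_mem hRmem.1 (signedPerm_one_mem_titsGL ε)

/-- The small generating set of the Tits group of `O_{2ℓ}`. -/
abbrev generatorsD (ℓ : ℕ) : Set (GLn (2 * ℓ)) :=
  dotD ℓ '' Set.Icc 1 ℓ ∪
    {tA (2 * ℓ) ℓ * tA (2 * ℓ) (ℓ + 1), tA (2 * ℓ) ℓ * dotA (2 * ℓ) ℓ}

theorem titsD_le {ℓ : ℕ} (hℓ : 2 ≤ ℓ) : titsD ℓ ≤ titsGL (2 * ℓ) ⊓ groupD ℓ :=
  sup_le (titsSOeven_le hℓ) ((Subgroup.closure_le _).2 fun _ => diagramLiftsD_subset hℓ)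

theorem closure_generatorsD_le {ℓ : ℕ} (hℓ : 2 ≤ ℓ) :
    Subgroup.closure (generatorsD ℓ) ≤ titsD ℓ := by
  rw [Subgroup.closure_le]
  rintro x (⟨k, ⟨hk₁, hk₂⟩, rfl⟩ | rfl | rfl)
  · exact Subgroup.mem_sup_left (titsElement_mem_titsGroup _ _ hk₁ hk₂)
  · refine Subgroup.mem_sup_left ?_
    obtain ⟨c, hc⟩ : ∃ c : Fin (2 * ℓ), c.val = ℓ - 1 := ⟨⟨ℓ - 1, by omega⟩, rfl⟩
    have hcr := Fin.val_rev c
    rw [tA_mul_tA_eq c (by omega) (by omega) (by omega), titsSOeven, groupD_eq]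
    exact mirrorSign_mem_titsGroup _
  · exact Subgroup.mem_sup_right (Subgroup.subset_closure (tA_mul_dotA_mem_diagramLiftsD hℓ))

theorem titsGL_inf_groupD_le {ℓ : ℕ} (hℓ : 2 ≤ ℓ) :
    titsGL (2 * ℓ) ⊓ groupD ℓ ≤ Subgroup.closure (generatorsD ℓ) := by
  have hK := (closure_generatorsD_le hℓ).trans ((titsD_le hℓ).trans inf_le_right)
  rw [groupD_eq] at hK ⊢
  refine titsGL_inf_fixedGroup_le hK (fun a b hab hb => ?_) (fun c hc hc2 => ?_)
    (fun c hc hc2 => ?_)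
  · have har := Fin.val_rev a
    have hbr := Fin.val_rev b
    rw [Fin.lt_def] at hb
    rw [← dotD_eq (k := ℓ - a.val) (by omega) a b b.rev a.rev (by omega) (by omega) (by omega)
      (by omega)]
    exact Subgroup.subset_closure (Or.inl ⟨_, ⟨by omega, by omega⟩, rfl⟩)
  · have hcr := Fin.val_rev c
    rw [Fin.lt_def] at hc
    -- The element Ṙ supplies the swap of the two central lines; the adjacent mirror pairs only use
    -- nodes `k ≥ 2`.
    refine ⟨fun _ => 1, ?_⟩
    rw [← tA_mul_dotA_eq c c.rev (by omega) (by omega)]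
    exact Subgroup.subset_closure (Or.inr (Or.inr rfl))
  · have hcr := Fin.val_rev c
    rw [Fin.le_def] at hc
    rw [← tA_mul_tA_eq (k := ℓ) (m := ℓ + 1) c (by omega) (by omega) (by omega)]
    exact Subgroup.subset_closure (Or.inr (Or.inl rfl))

end TitsFixed

theorem mainTheorem3 :
    -- `G = O_{2ℓ+1}`
    (∀ ℓ : ℕ, 1 ≤ ℓ →
      TitsFixed.titsGL (2 * ℓ + 1) ⊓ TitsFixed.groupB ℓ = TitsFixed.titsB ℓ ∧
      (TitsFixed.dotB ℓ 1 = TitsFixed.dotA (2 * ℓ + 1) ℓ *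
          TitsFixed.dotA (2 * ℓ + 1) (ℓ + 1) * TitsFixed.dotA (2 * ℓ + 1) ℓ ∧
        TitsFixed.dotB ℓ 1 = TitsFixed.dotA (2 * ℓ + 1) (ℓ + 1) *
          TitsFixed.dotA (2 * ℓ + 1) ℓ * TitsFixed.dotA (2 * ℓ + 1) (ℓ + 1)) ∧
      (∀ k : ℕ, 1 < k → k ≤ ℓ →
        TitsFixed.dotB ℓ k = TitsFixed.dotA (2 * ℓ + 1) (ℓ + 1 - k) *
          TitsFixed.dotA (2 * ℓ + 1) (ℓ + k) ∧
        TitsFixed.dotB ℓ k = TitsFixed.dotA (2 * ℓ + 1) (ℓ + k) *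
          TitsFixed.dotA (2 * ℓ + 1) (ℓ + 1 - k)) ∧
      TitsFixed.titsB ℓ = Subgroup.closure (TitsFixed.dotB ℓ '' Set.Icc 1 ℓ ∪
        {TitsFixed.tA (2 * ℓ + 1) (ℓ + 1),
          TitsFixed.tA (2 * ℓ + 1) ℓ * TitsFixed.tA (2 * ℓ + 1) (ℓ + 2)})) ∧
    -- `G = Sp_{2ℓ}`
    (∀ ℓ : ℕ, 1 ≤ ℓ →
      TitsFixed.titsGL (2 * ℓ) ⊓ TitsFixed.groupC ℓ = TitsFixed.titsC ℓ ∧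
      TitsFixed.dotC ℓ 1 = TitsFixed.dotA (2 * ℓ) ℓ ∧
      (∀ k : ℕ, 1 < k → k ≤ ℓ →
        TitsFixed.dotC ℓ k = TitsFixed.dotA (2 * ℓ) (ℓ + 1 - k) *
          TitsFixed.dotA (2 * ℓ) (ℓ + k - 1) ∧
        TitsFixed.dotC ℓ k = TitsFixed.dotA (2 * ℓ) (ℓ + k - 1) *
          TitsFixed.dotA (2 * ℓ) (ℓ + 1 - k)) ∧
      TitsFixed.titsC ℓ = Subgroup.closure (TitsFixed.dotC ℓ '' Set.Icc 1 ℓ)) ∧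
    -- `G = O_{2ℓ}`
    (∀ ℓ : ℕ, 2 ≤ ℓ →
      TitsFixed.titsGL (2 * ℓ) ⊓ TitsFixed.groupD ℓ = TitsFixed.titsD ℓ ∧
      (TitsFixed.dotD ℓ 1 = TitsFixed.dotA (2 * ℓ) ℓ * TitsFixed.dotA (2 * ℓ) (ℓ - 1) *
          (TitsFixed.dotA (2 * ℓ) (ℓ + 1))⁻¹ * (TitsFixed.dotA (2 * ℓ) ℓ)⁻¹ ∧
        TitsFixed.dotD ℓ 1 = TitsFixed.dotA (2 * ℓ) ℓ * (TitsFixed.dotA (2 * ℓ) (ℓ + 1))⁻¹ *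
          TitsFixed.dotA (2 * ℓ) (ℓ - 1) * (TitsFixed.dotA (2 * ℓ) ℓ)⁻¹ ∧
        TitsFixed.dotD ℓ 1 = TitsFixed.tA (2 * ℓ) (ℓ - 1) * TitsFixed.tA (2 * ℓ) ℓ *
          (TitsFixed.dotA (2 * ℓ) ℓ * TitsFixed.dotA (2 * ℓ) (ℓ - 1) *
            TitsFixed.dotA (2 * ℓ) (ℓ + 1) * TitsFixed.dotA (2 * ℓ) ℓ)) ∧
      (∀ k : ℕ, 1 < k → k ≤ ℓ →
        TitsFixed.dotD ℓ k = TitsFixed.dotA (2 * ℓ) (ℓ + 1 - k) *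
          TitsFixed.dotA (2 * ℓ) (ℓ + k - 1) ∧
        TitsFixed.dotD ℓ k = TitsFixed.dotA (2 * ℓ) (ℓ + k - 1) *
          TitsFixed.dotA (2 * ℓ) (ℓ + 1 - k)) ∧
      TitsFixed.tA (2 * ℓ) ℓ * TitsFixed.dotA (2 * ℓ) ℓ ∈ TitsFixed.diagramLiftsD ℓ ∧
      TitsFixed.titsD ℓ = Subgroup.closure (TitsFixed.dotD ℓ '' Set.Icc 1 ℓ ∪
        {TitsFixed.tA (2 * ℓ) ℓ * TitsFixed.tA (2 * ℓ) (ℓ + 1),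
          TitsFixed.tA (2 * ℓ) ℓ * TitsFixed.dotA (2 * ℓ) ℓ})) := by
  refine ⟨fun ℓ hℓ => ⟨?_, TitsFixed.dotB_one_braid hℓ,
    fun k h₁ h₂ => TitsFixed.dotB_eq_dotA_mul h₁ h₂, ?_⟩, fun ℓ hℓ => ⟨?_, TitsFixed.dotC_one_eq,
    fun k h₁ h₂ => TitsFixed.dotC_eq_dotA_mul h₁ h₂, ?_⟩, fun ℓ hℓ => ⟨?_,
    TitsFixed.dotD_one_formulas hℓ, fun k h₁ h₂ => TitsFixed.dotD_eq_dotA_mul h₁ h₂,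
    TitsFixed.tA_mul_dotA_mem_diagramLiftsD hℓ, ?_⟩⟩
  · exact le_antisymm ((TitsFixed.titsGL_inf_groupB_le hℓ).trans
      (TitsFixed.closure_generatorsB_le hℓ)) TitsFixed.titsB_le
  · exact le_antisymm (TitsFixed.titsB_le.trans (TitsFixed.titsGL_inf_groupB_le hℓ))
      (TitsFixed.closure_generatorsB_le hℓ)
  · exact le_antisymm ((TitsFixed.titsGL_inf_groupC_le hℓ).trans TitsFixed.closure_dotC_le)
      TitsFixed.titsC_le
  · exact le_antisymm (TitsFixed.titsC_le.trans (TitsFixed.titsGL_inf_groupC_le hℓ))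
      TitsFixed.closure_dotC_le
  · exact le_antisymm ((TitsFixed.titsGL_inf_groupD_le hℓ).trans
      (TitsFixed.closure_generatorsD_le hℓ)) (TitsFixed.titsD_le hℓ)
  · exact le_antisymm ((TitsFixed.titsD_le hℓ).trans (TitsFixed.titsGL_inf_groupD_le hℓ))
      (TitsFixed.closure_generatorsD_le hℓ)
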